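/- Write $H=L^2(\mathbb R)$, $V=H^1(\mathbb R)$ with $\|v\|_V^2=\|v\|_H^2+\|\partial_x v\|_H^2$, and $V^*$ for the dual of $V$, with $V\hookrightarrow H=H^*\hookrightarrow V^*$. For $T>0$ let $W(V)=\{y\in L^2(0,T;V) : \partial_t y\in L^2(0,T;V^*)\}$ with norm $\|y\|_{W(V)}^2=\|y\|_{L^2(0,T;V)}^2+\|\partial_t y\|_{L^2(0,T;V^*)}^2$; elements of $W(V)$ have a representative in $C([0,T];H)$, which defines $y(0)$. **Theorem.** Let $\nu>0$, $T>0$ and $\chi_c\in C_c^\infty(\mathbb R)$. There exists a constant $C>0$, depending only on $\nu$, $T$ and $\chi_c$, such that the following holds. Let $u\in H^1(0,T)$, let $y_0\in V$ have bounded support, and let $y\in W(V)\cap L^\infty(0,T;V)$ be a weak solution of the viscous Burgers equation $\partial_t y+y\,\partial_x y-\nu\,\partial_{xx}y=\chi_c u$ in $\mathbb R\times(0,T)$, $y(\cdot,0)=y_0$, that is, for all $\phi\in V$ and $\psi\in H$, $$\frac{d}{dt}\langle y(t),\phi\rangle_H+\langle y(t)\,\partial_x y(t),\phi\rangle_H+\nu\langle\partial_x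 y(t),\partial_x\phi\rangle_H=\langle \chi_c\,u(t),\phi\rangle_H\quad\text{for a.e. }t\in(0,T),\qquad \langle y(0),\psi\rangle_H=\langle y_0,\psi\rangle_H .$$ Then $$\|y\|_{L^\infty(0,T;V)}+\|y\|_{W(V)}\le C\,\bigl(\|u\|_{L^2(0,T)}+\|y_0\|_V\bigr)\,\exp\Bigl(C\bigl(\|u\|_{L^2(0,T)}^2+\|y_0\|_H^2\bigr)\Bigr).$$ -/

import Mathlib

open MeasureTheory Set
open scoped ContDiff

noncomputable section

namespace Burgers

/-- `g` is the weak (distributional) derivative of `f` on the open set `Ω ⊆ ℝ`; the functions may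
take values in a Banach space. Both are locally integrable on `Ω`, and
`∫ φ' f = -∫ φ g` for every `φ ∈ C_c^∞(Ω)`. -/
def HasWeakDerivOn {F : Type*} [NormedAddCommGroup F] [NormedSpace ℝ F]
    (Ω : Set ℝ) (f g : ℝ → F) : Prop :=
  LocallyIntegrableOn f Ω ∧ LocallyIntegrableOn g Ω ∧
    ∀ φ : ℝ → ℝ, ContDiff ℝ ∞ φ → HasCompactSupport φ → tsupport φ ⊆ Ω →
      ∫ x in Ω, deriv φ x • f x = -∫ x in Ω, φ x • g x

/-- The space `H = L²(ℝ)`. -/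
abbrev H : Type := Lp ℝ 2 (volume : Measure ℝ)

theorem locallyIntegrable_H (f : H) : LocallyIntegrable f volume :=
  (Lp.memLp f).locallyIntegrable one_le_two

theorem integrable_smul_H {φ : ℝ → ℝ} (hφ : Continuous φ) (hc : HasCompactSupport φ) (f : H) :
    Integrable (fun x => φ x • f x) volume :=
  (locallyIntegrable_H f).integrable_smul_left_of_hasCompactSupport hφ hc

/-- The Sobolev space `V = H¹(ℝ)`, realised as the space of all pairs `(f, f')` in
`L²(ℝ) × L²(ℝ)` in which `f'` is the weak derivative of `f`. The norm inherited from the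
`ℓ²`-product is `‖f‖_V = (‖f‖_H² + ‖f'‖_H²)^{1/2}`. -/
def H1 : Submodule ℝ (WithLp 2 (H × H)) where
  carrier := {p | HasWeakDerivOn univ (p.fst : ℝ → ℝ) (p.snd : ℝ → ℝ)}
  zero_mem' := by
    refine ⟨(locallyIntegrable_H _).locallyIntegrableOn _,
      (locallyIntegrable_H _).locallyIntegrableOn _, fun φ _ _ _ => ?_⟩
    simp
  add_mem' := by
    rintro p q ⟨-, -, hp⟩ ⟨-, -, hq⟩
    refine ⟨(locallyIntegrable_H _).locallyIntegrableOn _,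
      (locallyIntegrable_H _).locallyIntegrableOn _, fun φ h1 h2 h3 => ?_⟩
    have key : ∀ a : ℝ → ℝ, Continuous a → HasCompactSupport a → ∀ f g : H,
        ∫ x in univ, a x • ((f + g : H) : ℝ → ℝ) x
          = (∫ x in univ, a x • f x) + ∫ x in univ, a x • g x := by
      intro a ha hc f g
      rw [← integral_add (integrable_smul_H ha hc f).integrableOn
        (integrable_smul_H ha hc g).integrableOn]
      apply integral_congr_ae
      filter_upwards [ae_restrict_of_ae (Lp.coeFn_add f g)] with x hx
      simp only [hx, Pi.add_apply, smul_add]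
    have e1 := key (deriv φ) (h1.continuous_deriv (by simp)) h2.deriv p.fst q.fst
    have e2 := key φ h1.continuous h2 p.snd q.snd
    have hp' := hp φ h1 h2 h3
    have hq' := hq φ h1 h2 h3
    rw [WithLp.add_fst, WithLp.add_snd, e1, e2, hp', hq', neg_add]
  smul_mem' := by
    rintro c p ⟨-, -, hp⟩
    refine ⟨(locallyIntegrable_H _).locallyIntegrableOn _,
      (locallyIntegrable_H _).locallyIntegrableOn _, fun φ h1 h2 h3 => ?_⟩
    have key : ∀ a : ℝ → ℝ, ∀ f : H,
        ∫ x in univ, a x • ((c • f : H) : ℝ → ℝ) x = c * ∫ x in univ, a x • f x := by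
      intro a f
      rw [← integral_const_mul]
      apply integral_congr_ae
      filter_upwards [ae_restrict_of_ae (Lp.coeFn_smul c f)] with x hx
      simp only [hx, Pi.smul_apply, smul_eq_mul]
      ring
    rw [WithLp.smul_fst, WithLp.smul_snd, key, key, hp φ h1 h2 h3, mul_neg]

/-- The space `V = H¹(ℝ)` as a type, with the `H¹` norm. -/
abbrev V : Type := ↥H1

/-- The embedding `V ↪ H`. -/
def toH : V →L[ℝ] H := (WithLp.fstL 2 ℝ H H).comp H1.subtypeL

/-- The weak derivative `∂ₓ : V → H`. -/
def dx : V →L[ℝ] H := (WithLp.sndL 2 ℝ H H).comp H1.subtypeL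

/-- The dual space `V*` with the operator norm. -/
abbrev VDual : Type := V →L[ℝ] ℝ

/-- The embedding `V ↪ H = H* ↪ V*`, that is `v ↦ ⟨v, ·⟩_H`. -/
def toDual (v : V) : VDual := (innerSL ℝ (toH v)).comp toH

/-- `v ∈ V` has bounded support: it vanishes a.e. outside a compact interval. -/
def HasBoundedSupport (v : V) : Prop :=
  ∃ a b : ℝ, a ≤ b ∧ ∀ᵐ x : ℝ, x ∉ Icc a b → toH v x = 0

/-- Lebesgue measure on the time interval `(0, T)`. -/
abbrev timeMeasure (T : ℝ) : Measure ℝ := volume.restrict (Ioo 0 T)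

/-- The norm of `L^p(0,T;E)` (for `f` in that space). -/
def normLp {E : Type*} [NormedAddCommGroup E] (p : ENNReal) (T : ℝ) (f : ℝ → E) : ℝ :=
  (eLpNorm f p (timeMeasure T)).toReal

/-- `u ∈ H¹(0,T)`. -/
def MemH1Time (T : ℝ) (u : ℝ → ℝ) : Prop :=
  MemLp u 2 (timeMeasure T) ∧
    ∃ du : ℝ → ℝ, MemLp du 2 (timeMeasure T) ∧ HasWeakDerivOn (Ioo 0 T) u du

/-- `y ∈ W(V)` with time derivative `dy`: `y ∈ L²(0,T;V)`, `dy ∈ L²(0,T;V*)` and `dy` is the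
weak derivative in time of `y`, regarded as a function with values in `V*`. -/
structure MemW (T : ℝ) (y : ℝ → V) (dy : ℝ → VDual) : Prop where
  memLp : MemLp y 2 (timeMeasure T)
  memLp_deriv : MemLp dy 2 (timeMeasure T)
  hasWeakDeriv : HasWeakDerivOn (Ioo 0 T) (fun t => toDual (y t)) dy

/-- The norm `‖y‖_{W(V)} = (‖y‖_{L²(V)}² + ‖∂_t y‖_{L²(V*)}²)^{1/2}`, where `dy = ∂_t y`. -/
def normW (T : ℝ) (y : ℝ → V) (dy : ℝ → VDual) : ℝ :=
  Real.sqrt (normLp 2 T y ^ 2 + normLp 2 T dy ^ 2)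

/-- The initial condition `⟨y(0), ψ⟩_H = ⟨y₀, ψ⟩_H` for all `ψ ∈ H`, where `y(0)` is the value at
`t = 0` of the representative of `y` in `C([0,T]; H)`. -/
def HasInitialValue (T : ℝ) (y : ℝ → V) (y₀ : V) : Prop :=
  ∃ z : ℝ → H, ContinuousOn z (Icc 0 T) ∧ (∀ᵐ t ∂timeMeasure T, toH (y t) = z t) ∧
    ∀ ψ : H, inner ℝ (z 0) ψ = inner ℝ (toH y₀) ψ

/-- The weak form of `∂_t y + y ∂ₓy - ν ∂ₓₓy = χ u` with `y(0) = y₀`: for every `φ ∈ V`, the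
scalar function `t ↦ ⟨y(t), φ⟩_H` has a weak derivative `w` on `(0,T)`, and for a.e. `t ∈ (0,T)`
`w(t) + ⟨y(t) ∂ₓy(t), φ⟩_H + ν ⟨∂ₓy(t), ∂ₓφ⟩_H = ⟨χ u(t), φ⟩_H`. -/
structure IsWeakSolution (ν T : ℝ) (χ u : ℝ → ℝ) (y₀ : V) (y : ℝ → V) : Prop where
  equation : ∀ φ : V, ∃ w : ℝ → ℝ,
    HasWeakDerivOn (Ioo 0 T) (fun t => inner ℝ (toH (y t)) (toH φ)) w ∧
    ∀ᵐ t ∂timeMeasure T,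
      w t + (∫ x, (toH (y t) x * dx (y t) x) * toH φ x) + ν * inner ℝ (dx (y t)) (dx φ)
        = ∫ x, (χ x * u t) * toH φ x
  initial : HasInitialValue T y y₀

end Burgers

end

/-!
Testing the equation with `y` kills the convection term, since `⟨v ∂ₓv, v⟩ = ∫ (v³ / 3)' = 0`, and
Gronwall's inequality bounds `y` in `L^∞(0,T;H) ∩ L²(0,T;V)` by the data. The bound in
`L^∞(0,T;V)` would follow from testing with `-∂ₓₓy`, which does not lie in `V`; one tests with
`D_h^* D_h y` instead, `D_h` being the difference quotient, and lets `h → 0` at the end. The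
convection term is then controlled by Agmon's inequality `‖v‖_∞² ≤ 2 ‖v‖_H ‖∂ₓv‖_H`, which gives
`d/dt ‖D_h y‖² ≤ ‖f‖² / ν + (2 / ν) ‖y‖_H ‖∂ₓy‖_H ‖∂ₓy‖_H²`; the coefficient of `‖∂ₓy‖_H²` is
integrable in time by the first estimate, so Gronwall's inequality applies and produces the
exponential. The equation itself then bounds `∂_t y` in `L²(0,T;V*)`.

Both energy identities are instances of a chain rule for `‖D y(t)‖²` with `D` bounded on `H`: by
convexity `2 ⟨D y(s) - D y(t), D y(t)⟩ ≤ ‖D y(s)‖² - ‖D y(t)‖²`, where the left-hand side is a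
pairing in `V* × V` with `∫_t^s ∂_t y`, and this inequality makes the energy absolutely continuous
and identifies its derivative.
-/

noncomputable section

namespace Burgers

open Filter Topology

/-! ### Weak derivatives on intervals -/

section WeakDerivative

variable {F : Type*} [NormedAddCommGroup F] [NormedSpace ℝ F]

/-- A smooth approximation of the Heaviside function: the primitive of a normalised bump. -/
def smoothStep (ρ : ContDiffBump (0 : ℝ)) (x : ℝ) : ℝ :=
  ∫ r in (-ρ.rOut)..x, ρ.normed volume r

/-- A smooth approximation of the indicator function of `[s, t]`. -/
def plateau (ρ : ContDiffBump (0 : ℝ)) (s t x : ℝ) : ℝ :=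
  smoothStep ρ (x - s) - smoothStep ρ (x - t)

section Plateau

variable (ρ : ContDiffBump (0 : ℝ))

theorem hasDerivAt_smoothStep (x : ℝ) : HasDerivAt (smoothStep ρ) (ρ.normed volume x) x :=
  intervalIntegral.integral_hasDerivAt_right (ρ.continuous_normed.intervalIntegrable _ _)
    (ρ.continuous_normed.stronglyMeasurableAtFilter _ _) ρ.continuous_normed.continuousAt

theorem contDiff_smoothStep : ContDiff ℝ ∞ (smoothStep ρ) := by
  rw [contDiff_infty_iff_deriv, funext fun x => (hasDerivAt_smoothStep ρ x).deriv]
  exact ⟨fun x => (hasDerivAt_smoothStep ρ x).differentiableAt, ρ.contDiff_normed (n := ⊤)⟩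

theorem monotone_smoothStep : Monotone (smoothStep ρ) :=
  monotone_of_hasDerivAt_nonneg (hasDerivAt_smoothStep ρ) ρ.nonneg_normed

theorem normed_eq_zero_of_rOut_le_abs {x : ℝ} (hx : ρ.rOut ≤ |x|) : ρ.normed volume x = 0 := by
  rw [← Function.notMem_support, ρ.support_normed_eq]
  simpa using hx

theorem smoothStep_of_le {x : ℝ} (hx : x ≤ -ρ.rOut) : smoothStep ρ x = 0 := by
  refine (intervalIntegral.integral_congr (g := fun _ => (0 : ℝ)) fun r hr => ?_).trans
    intervalIntegral.integral_zero
  rw [uIcc_of_ge hx] at hr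
  exact normed_eq_zero_of_rOut_le_abs ρ ((le_neg_of_le_neg hr.2).trans (neg_le_abs r))

theorem smoothStep_of_ge {x : ℝ} (hx : ρ.rOut ≤ x) : smoothStep ρ x = 1 := by
  rw [smoothStep, intervalIntegral.integral_of_le (by linarith [ρ.rOut_pos]),
    ← ρ.integral_normed (μ := volume), setIntegral_eq_integral_of_forall_compl_eq_zero]
  intro r hr
  refine normed_eq_zero_of_rOut_le_abs ρ ?_
  by_contra! h
  rw [abs_lt] at h
  exact hr ⟨h.1, h.2.le.trans hx⟩

theorem smoothStep_mem_Icc (x : ℝ) : smoothStep ρ x ∈ Icc (0 : ℝ) 1 := by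
  constructor
  · rw [← smoothStep_of_le ρ (min_le_right x (-ρ.rOut))]
    exact monotone_smoothStep ρ (min_le_left _ _)
  · rw [← smoothStep_of_ge ρ (le_max_right x ρ.rOut)]
    exact monotone_smoothStep ρ (le_max_left _ _)

theorem hasDerivAt_plateau (s t x : ℝ) : HasDerivAt (plateau ρ s t)
    (ρ.normed volume (x - s) - ρ.normed volume (x - t)) x :=
  ((hasDerivAt_smoothStep ρ _).comp_sub_const x s).sub
    ((hasDerivAt_smoothStep ρ _).comp_sub_const x t)

theorem contDiff_plateau (s t : ℝ) : ContDiff ℝ ∞ (plateau ρ s t) :=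
  ((contDiff_smoothStep ρ).comp (contDiff_id.sub contDiff_const)).sub
    ((contDiff_smoothStep ρ).comp (contDiff_id.sub contDiff_const))

theorem plateau_eq_zero {s t x : ℝ} (hst : s ≤ t)
    (hx : x ∉ Icc (s - ρ.rOut) (t + ρ.rOut)) : plateau ρ s t x = 0 := by
  rw [mem_Icc, not_and_or, not_le, not_le] at hx
  rw [plateau]
  rcases hx with hx | hx
  · rw [smoothStep_of_le ρ (by linarith), smoothStep_of_le ρ (by linarith), sub_zero]
  · rw [smoothStep_of_ge ρ (by linarith), smoothStep_of_ge ρ (by linarith), sub_self]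

theorem plateau_eq_one {s t x : ℝ} (hx : x ∈ Icc (s + ρ.rOut) (t - ρ.rOut)) :
    plateau ρ s t x = 1 := by
  rw [plateau, smoothStep_of_ge ρ (le_sub_iff_add_le'.2 hx.1),
    smoothStep_of_le ρ (by linarith [hx.2]), sub_zero]

theorem tsupport_plateau_subset {s t : ℝ} (hst : s ≤ t) :
    tsupport (plateau ρ s t) ⊆ Icc (s - ρ.rOut) (t + ρ.rOut) :=
  closure_minimal (fun _ hx => of_not_not fun h => hx (plateau_eq_zero ρ hst h)) isClosed_Icc

theorem abs_plateau_le_one (s t x : ℝ) : |plateau ρ s t x| ≤ 1 := by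
  have h₁ := smoothStep_mem_Icc ρ (x - s)
  have h₂ := smoothStep_mem_Icc ρ (x - t)
  rw [plateau, abs_le]
  constructor <;> linarith [h₁.1, h₁.2, h₂.1, h₂.2]

theorem convolution_normed_eq (f : ℝ → F) (s : ℝ) :
    convolution (ρ.normed volume) f (ContinuousLinearMap.lsmul ℝ ℝ) volume s
      = ∫ x, ρ.normed volume (x - s) • f x := by
  rw [convolution_eq_swap]
  congr 1 with x
  rw [← neg_sub, ρ.normed_neg]
  rfl

theorem HasWeakDerivOn.integral_plateau_smul {Ω : Set ℝ} {f g : ℝ → F} (hΩ : MeasurableSet Ω)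
    (hf : LocallyIntegrable (Ω.indicator f)) (h : HasWeakDerivOn Ω f g) {s t : ℝ} (hst : s ≤ t)
    (hsub : Icc (s - ρ.rOut) (t + ρ.rOut) ⊆ Ω) :
    ∫ x, plateau ρ s t x • Ω.indicator g x =
      (∫ x, ρ.normed volume (x - t) • Ω.indicator f x) -
        ∫ x, ρ.normed volume (x - s) • Ω.indicator f x := by
  have hsupp := tsupport_plateau_subset ρ hst
  have hparts := h.2.2 _ (contDiff_plateau ρ s t)
    (isCompact_Icc.of_isClosed_subset (isClosed_tsupport _) hsupp) (hsupp.trans hsub)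
  have hint (r : ℝ) : Integrable fun x => ρ.normed volume (x - r) • Ω.indicator f x :=
    hf.integrable_smul_left_of_hasCompactSupport
      (ρ.continuous_normed.comp (continuous_sub_right r))
      (ρ.hasCompactSupport_normed.comp_homeomorph (Homeomorph.subRight r))
  rw [← integral_indicator hΩ, ← integral_indicator hΩ] at hparts
  simp only [indicator_smul, (hasDerivAt_plateau ρ s t _).deriv] at hparts
  simp only [sub_smul] at hparts
  rw [integral_sub (hint s) (hint t)] at hparts
  rw [← neg_sub, hparts, neg_neg]

end Plateau

/-- A sequence of bump functions at the origin whose supports shrink to a point. -/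
def bumpSeq (n : ℕ) : ContDiffBump (0 : ℝ) where
  rIn := 1 / (n + 1)
  rOut := 2 / (n + 1)
  rIn_pos := by positivity
  rIn_lt_rOut := by gcongr; norm_num

theorem bumpSeq_rOut_le_two (n : ℕ) : (bumpSeq n).rOut ≤ 2 :=
  div_le_self zero_le_two (by simp)

theorem tendsto_bumpSeq_rOut : Tendsto (fun n => (bumpSeq n).rOut) atTop (𝓝 0) := by
  simpa [bumpSeq, div_eq_mul_inv] using
    (tendsto_one_div_add_atTop_nhds_zero_nat (𝕜 := ℝ)).const_mul 2

theorem ae_tendsto_integral_normed_bumpSeq_smul {f : ℝ → F} (hf : LocallyIntegrable f)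
    [CompleteSpace F] :
    ∀ᵐ s, Tendsto (fun n => ∫ x, (bumpSeq n).normed volume (x - s) • f x) atTop (𝓝 (f s)) := by
  simpa only [convolution_normed_eq] using
    ContDiffBump.ae_convolution_tendsto_right_of_locallyIntegrable (μ := volume)
      (φ := bumpSeq) (K := 2) tendsto_bumpSeq_rOut
      (.of_forall fun n => by simp only [bumpSeq]; rw [← mul_div_assoc, mul_one]) hf

theorem eventually_plateau_bumpSeq_eq {s t x : ℝ} (hst : s ≤ t) (hxs : x ≠ s) (hxt : x ≠ t) :
    ∀ᶠ n in atTop, plateau (bumpSeq n) s t x = (Ioc s t).indicator 1 x := by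
  filter_upwards
    [tendsto_bumpSeq_rOut.eventually_lt_const (abs_pos.2 (sub_ne_zero.2 hxs)),
      tendsto_bumpSeq_rOut.eventually_lt_const (abs_pos.2 (sub_ne_zero.2 hxt))] with n hns hnt
  by_cases hx : x ∈ Ioc s t
  · rw [abs_of_pos (sub_pos.2 hx.1)] at hns
    rw [abs_of_neg (sub_neg.2 (hx.2.lt_of_ne hxt))] at hnt
    rw [indicator_of_mem hx, plateau_eq_one _ ⟨by linarith, by linarith⟩, Pi.one_apply]
  · rw [indicator_of_notMem hx]
    refine plateau_eq_zero _ hst fun hx' => hx ⟨?_, ?_⟩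
    · by_contra! h
      rw [abs_of_nonpos (sub_nonpos.2 h)] at hns
      linarith [hx'.1]
    · by_contra! h
      rw [abs_of_pos (sub_pos.2 h)] at hnt
      linarith [hx'.2]

theorem tendsto_integral_plateau_smul {g : ℝ → F} (hg : LocallyIntegrable g) {s t : ℝ}
    (hst : s ≤ t) : Tendsto (fun n => ∫ x, plateau (bumpSeq n) s t x • g x) atTop
      (𝓝 (∫ x in s..t, g x)) := by
  rw [intervalIntegral.integral_of_le hst, ← integral_indicator measurableSet_Ioc]
  refine tendsto_integral_of_dominated_convergence
    ((Icc (s - 2) (t + 2)).indicator fun x => ‖g x‖) (fun n => ?_) ?_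
    (fun n => .of_forall fun x => ?_) ?_
  · exact (contDiff_plateau _ s t).continuous.aestronglyMeasurable.smul hg.aestronglyMeasurable
  · rw [integrable_indicator_iff measurableSet_Icc]
    exact (hg.integrableOn_isCompact isCompact_Icc).norm
  · have hr := bumpSeq_rOut_le_two n
    by_cases hx : x ∈ Icc (s - 2) (t + 2)
    · rw [indicator_of_mem hx, norm_smul]
      exact mul_le_of_le_one_left (norm_nonneg _) (abs_plateau_le_one _ s t x)
    · rw [indicator_of_notMem hx, plateau_eq_zero _ hst
        fun h => hx (Icc_subset_Icc (by linarith) (by linarith) h), zero_smul, norm_zero]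
  · filter_upwards [Measure.ae_ne volume s, Measure.ae_ne volume t] with x hxs hxt
    refine tendsto_const_nhds.congr' ?_
    filter_upwards [eventually_plateau_bumpSeq_eq hst hxs hxt] with n hn
    rw [hn, ← indicator_smul_apply_left]
    simp

theorem HasWeakDerivOn.exists_ae_sub_eq_integral [CompleteSpace F] {Ω : Set ℝ} {f g : ℝ → F}
    (h : HasWeakDerivOn Ω f g) (hΩ : IsOpen Ω) (hc : OrdConnected Ω)
    (hf : LocallyIntegrable (Ω.indicator f)) (hg : LocallyIntegrable (Ω.indicator g)) :
    ∃ G : Set ℝ, (∀ᵐ s, s ∈ G) ∧ ∀ s ∈ G ∩ Ω, ∀ t ∈ G ∩ Ω, f t - f s = ∫ x in s..t, g x := by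
  refine ⟨{s | Tendsto (fun n => ∫ x, (bumpSeq n).normed volume (x - s) • Ω.indicator f x) atTop
    (𝓝 (Ω.indicator f s))}, ae_tendsto_integral_normed_bumpSeq_smul hf, ?_⟩
  rintro s ⟨hs, hsΩ⟩ t ⟨ht, htΩ⟩
  wlog hst : s ≤ t generalizing s t
  · rw [intervalIntegral.integral_symm, ← this t ht htΩ s hs hsΩ (le_of_not_ge hst), neg_sub]
  rw [mem_ofPred, indicator_of_mem hsΩ] at hs
  rw [mem_ofPred, indicator_of_mem htΩ] at ht
  have hindicator : ∫ x in s..t, Ω.indicator g x = ∫ x in s..t, g x :=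
    intervalIntegral.integral_congr fun x hx =>
      indicator_of_mem (hc.out hsΩ htΩ (by rwa [uIcc_of_le hst] at hx)) _
  obtain ⟨ε, hε, hεs⟩ := Metric.isOpen_iff.1 hΩ s hsΩ
  obtain ⟨δ, hδ, hδt⟩ := Metric.isOpen_iff.1 hΩ t htΩ
  refine tendsto_nhds_unique ((ht.sub hs).congr' ?_)
    (hindicator ▸ tendsto_integral_plateau_smul hg hst)
  filter_upwards [tendsto_bumpSeq_rOut.eventually_lt_const hε,
    tendsto_bumpSeq_rOut.eventually_lt_const hδ] with n hnε hnδ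
  have hr := (bumpSeq n).rOut_pos
  refine (h.integral_plateau_smul _ hΩ.measurableSet hf hst (hc.out (hεs ?_) (hδt ?_))).symm
  · rwa [Metric.mem_ball, Real.dist_eq, sub_sub_cancel_left, abs_neg, abs_of_pos hr]
  · rwa [Metric.mem_ball, Real.dist_eq, add_sub_cancel_left, abs_of_pos hr]

theorem integrableOn_smul_of_tsupport_subset {Ω : Set ℝ} {f : ℝ → F}
    (hf : LocallyIntegrableOn f Ω) {φ : ℝ → ℝ} (hφ : Continuous φ) (hc : HasCompactSupport φ)
    (hs : tsupport φ ⊆ Ω) : IntegrableOn (fun x => φ x • f x) Ω := by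
  have h : IntegrableOn (fun x => φ x • f x) (tsupport φ) :=
    (hf.integrableOn_compact_subset hs hc).continuousOn_smul hφ.continuousOn hc
  exact (h.integrable_of_forall_notMem_eq_zero fun x hx => by
    rw [image_eq_zero_of_notMem_tsupport hx, zero_smul]).integrableOn

theorem HasWeakDerivOn.clm_comp [CompleteSpace F] {E : Type*} [NormedAddCommGroup E]
    [NormedSpace ℝ E] [CompleteSpace E] {Ω : Set ℝ} {f g : ℝ → F} (h : HasWeakDerivOn Ω f g)
    (L : F →L[ℝ] E) : HasWeakDerivOn Ω (fun x => L (f x)) (fun x => L (g x)) := by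
  have hloc {k : ℝ → F} (hk : LocallyIntegrableOn k Ω) :
      LocallyIntegrableOn (fun x => L (k x)) Ω := fun x hx =>
    let ⟨s, hs, hks⟩ := hk x hx
    ⟨s, hs, L.integrable_comp hks.integrable⟩
  refine ⟨hloc h.1, hloc h.2.1, fun φ hφ hc hs => ?_⟩
  simp only [← map_smul]
  rw [L.integral_comp_comm (integrableOn_smul_of_tsupport_subset h.1
      (hφ.continuous_deriv (by simp)) hc.deriv (tsupport_deriv_subset.trans hs)),
    L.integral_comp_comm (integrableOn_smul_of_tsupport_subset h.2.1 hφ.continuous hc hs),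
    h.2.2 φ hφ hc hs, map_neg]

theorem HasWeakDerivOn.ae_eq [CompleteSpace F] {Ω : Set ℝ} (hΩ : IsOpen Ω) {f g₁ g₂ : ℝ → F}
    (h₁ : HasWeakDerivOn Ω f g₁) (h₂ : HasWeakDerivOn Ω f g₂) :
    ∀ᵐ t ∂volume.restrict Ω, g₁ t = g₂ t := by
  have hzero := hΩ.ae_eq_zero_of_integral_contDiff_smul_eq_zero (μ := volume)
    (h₁.2.1.sub h₂.2.1) fun φ hφ hc hs => by
      rw [← setIntegral_eq_integral_of_forall_compl_eq_zero (s := Ω) fun x hx => by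
        rw [image_eq_zero_of_notMem_tsupport fun h => hx (hs h), zero_smul]]
      simp only [Pi.sub_apply, smul_sub]
      rw [integral_sub (integrableOn_smul_of_tsupport_subset h₁.2.1 hφ.continuous hc hs)
        (integrableOn_smul_of_tsupport_subset h₂.2.1 hφ.continuous hc hs), sub_eq_zero,
        ← neg_inj, ← h₁.2.2 φ hφ hc hs, ← h₂.2.2 φ hφ hc hs]
  rw [ae_restrict_iff' hΩ.measurableSet]
  exact hzero.mono fun t ht hΩt => sub_eq_zero.1 (ht hΩt)

end WeakDerivative

/-! ### Absolutely continuous functions -/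

section AbsolutelyContinuous

variable {a b : ℝ}

theorem absolutelyContinuousOnInterval_of_dist_le {X Y : Type*} [PseudoMetricSpace X]
    [PseudoMetricSpace Y] {f : ℝ → X} {g : ℝ → Y} {K : ℝ}
    (hg : AbsolutelyContinuousOnInterval g a b)
    (h : ∀ s ∈ uIcc a b, ∀ t ∈ uIcc a b, dist (f s) (f t) ≤ K * dist (g s) (g t)) :
    AbsolutelyContinuousOnInterval f a b := by
  have hg' := Tendsto.const_mul K hg
  rw [mul_zero] at hg'
  refine squeeze_zero' (.of_forall fun _ => Finset.sum_nonneg fun _ _ => dist_nonneg) ?_ hg'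
  filter_upwards [mem_inf_of_right (mem_principal_self _)] with I hI
  rw [Finset.mul_sum]
  exact Finset.sum_le_sum fun i hi => h _ (hI.1 i hi).1 _ (hI.1 i hi).2

theorem absolutelyContinuousOnInterval_comp_of_contDiff {E : Type*} [NormedAddCommGroup E]
    [NormedSpace ℝ E] {f : ℝ → E} {g : ℝ → ℝ} (hf : ContDiff ℝ 1 f)
    (hg : AbsolutelyContinuousOnInterval g a b) :
    AbsolutelyContinuousOnInterval (fun x => f (g x)) a b := by
  obtain ⟨C, hC⟩ := hg.exists_bound
  obtain ⟨K, hK⟩ := hf.contDiffOn.exists_lipschitzOnWith (s := Icc (-C) C) (by decide)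
    (convex_Icc _ _) isCompact_Icc
  exact absolutelyContinuousOnInterval_of_dist_le hg fun s hs t ht =>
    hK.dist_le_mul _ (abs_le.1 (hC s hs)) _ (abs_le.1 (hC t ht))

theorem integral_eq_sub_of_ae_hasDerivAt {f f' : ℝ → ℝ} (hf : AbsolutelyContinuousOnInterval f a b)
    (h : ∀ᵐ x, x ∈ uIcc a b → HasDerivAt f (f' x) x) : ∫ x in a..b, f' x = f b - f a := by
  rw [← hf.integral_deriv_eq_sub]
  refine intervalIntegral.integral_congr_ae ?_
  filter_upwards [h] with x hx hxab
  exact (hx (uIoc_subset_uIcc hxab)).deriv.symm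

theorem le_mul_exp_of_ae_deriv_le {Φ β : ℝ → ℝ} (hab : a ≤ b)
    (hΦ : AbsolutelyContinuousOnInterval Φ a b) (hβ : IntervalIntegrable β volume a b)
    (h : ∀ᵐ t ∂volume.restrict (Ioo a b), deriv Φ t ≤ β t * Φ t) :
    Φ b ≤ Φ a * Real.exp (∫ s in a..b, β s) := by
  set w : ℝ → ℝ := fun t => Real.exp (-∫ s in a..t, β s)
  have hw : AbsolutelyContinuousOnInterval w a b :=
    absolutelyContinuousOnInterval_comp_of_contDiff Real.contDiff_exp
      (hβ.absolutelyContinuousOnInterval_intervalIntegral left_mem_uIcc).neg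
  have hderiv : ∀ᵐ t, t ∈ uIcc a b →
      HasDerivAt (fun t => Φ t * w t) ((deriv Φ t - β t * Φ t) * w t) t := by
    filter_upwards [hΦ.ae_differentiableAt, hβ.ae_hasDerivAt_integral] with t hΦt hβt ht
    have hwt : HasDerivAt w (w t * -β t) t := (hβt ht a left_mem_uIcc).fun_neg.exp
    exact ((hΦt ht).hasDerivAt.fun_mul hwt).congr_deriv (by ring)
  have hmono : Φ b * w b - Φ a * w a ≤ 0 := by
    rw [← integral_eq_sub_of_ae_hasDerivAt (hΦ.fun_mul hw) hderiv,
      intervalIntegral.integral_of_le hab, integral_Ioc_eq_integral_Ioo]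
    refine integral_nonpos_of_ae (h.mono fun t ht => ?_)
    exact mul_nonpos_of_nonpos_of_nonneg (sub_nonpos.2 ht) (Real.exp_pos _).le
  simp only [w, intervalIntegral.integral_same, neg_zero, Real.exp_zero, mul_one] at hmono
  rwa [sub_nonpos, Real.exp_neg, mul_inv_le_iff₀ (Real.exp_pos _)] at hmono

theorem ae_le_mul_exp_of_ae_le_add_integral {A : ℝ} {β f : ℝ → ℝ} (hA : 0 ≤ A)
    (hβ : IntervalIntegrable β volume a b) (hβ0 : ∀ t, 0 ≤ β t)
    (hβf : IntervalIntegrable (fun t => β t * f t) volume a b)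
    (h : ∀ᵐ t ∂volume.restrict (Ioo a b), f t ≤ A + ∫ s in a..t, β s * f s) :
    ∀ᵐ t ∂volume.restrict (Ioo a b), f t ≤ A * Real.exp (∫ s in a..b, β s) := by
  set Φ : ℝ → ℝ := fun t => A + ∫ s in a..t, β s * f s
  have hΦ : AbsolutelyContinuousOnInterval Φ a b :=
    absolutelyContinuousOnInterval_of_dist_le (K := 1)
      (hβf.absolutelyContinuousOnInterval_intervalIntegral left_mem_uIcc)
      fun s _ t _ => by simp [Φ]
  have hderiv : ∀ᵐ t ∂volume.restrict (Ioo a b), deriv Φ t ≤ β t * Φ t := by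
    filter_upwards [h, ae_restrict_of_ae hβf.ae_hasDerivAt_integral,
      ae_restrict_mem measurableSet_Ioo] with t ht hβft htab
    have htab' : t ∈ uIcc a b := Icc_subset_uIcc (Ioo_subset_Icc_self htab)
    rw [((hβft htab' a left_mem_uIcc).const_add A).deriv]
    exact mul_le_mul_of_nonneg_left ht (hβ0 t)
  filter_upwards [h, ae_restrict_mem measurableSet_Ioo] with t ht htab
  have hsub : uIcc a t ⊆ uIcc a b :=
    uIcc_subset_uIcc_left (Icc_subset_uIcc (Ioo_subset_Icc_self htab))
  calc f t ≤ Φ t := ht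
    _ ≤ Φ a * Real.exp (∫ s in a..t, β s) :=
        le_mul_exp_of_ae_deriv_le htab.1.le (hΦ.mono hsub) (hβ.mono_set hsub)
          (ae_restrict_of_ae_restrict_of_subset (Ioo_subset_Ioo_right htab.2.le) hderiv)
    _ ≤ A * Real.exp (∫ s in a..b, β s) := by
        simp only [Φ, intervalIntegral.integral_same, add_zero]
        gcongr
        exact intervalIntegral.integral_mono_interval le_rfl htab.1.le htab.2.le
          (.of_forall hβ0) hβ

theorem le_on_Icc_of_ae_le (hab : a < b) {f g : ℝ → ℝ} (hf : ContinuousOn f (Icc a b))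
    (hg : ContinuousOn g (Icc a b)) (h : ∀ᵐ t ∂volume.restrict (Ioo a b), f t ≤ g t) :
    ∀ t ∈ Icc a b, f t ≤ g t := by
  rw [restrict_Ioo_eq_restrict_Icc] at h
  have hmax : (fun t => max (f t) (g t)) =ᵐ[volume.restrict (Icc a b)] g :=
    h.mono fun t ht => max_eq_right ht
  exact fun t ht => max_eq_right_iff.1
    (Measure.eqOn_Icc_of_ae_eq volume hab.ne hmax (hf.sup hg) hg ht)

end AbsolutelyContinuous

/-! ### The chain rule along a subgradient -/

section Subgradient

variable {F : Type*} [NormedAddCommGroup F] [NormedSpace ℝ F]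
  {a b M : ℝ} {E : ℝ → ℝ} {g : ℝ → F} {p : ℝ → F →L[ℝ] ℝ}

theorem continuousOn_integral_Icc (hab : a ≤ b) (hg : IntervalIntegrable g volume a b) {t : ℝ}
    (ht : t ∈ Icc a b) : ContinuousOn (fun s => ∫ x in t..s, g x) (Icc a b) := by
  rw [← uIcc_of_le hab] at ht ⊢
  exact intervalIntegral.continuousOn_primitive_interval' hg ht

theorem ae_subgradient_le_of_ae_ae (hab : a < b) (hg : IntervalIntegrable g volume a b)
    (hE : ContinuousOn E (Icc a b))
    (h : ∀ᵐ t ∂volume.restrict (Ioo a b), ∀ᵐ s ∂volume.restrict (Ioo a b),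
      p t (∫ x in t..s, g x) ≤ E s - E t) :
    ∀ᵐ t ∂volume.restrict (Ioo a b), ∀ s ∈ Icc a b, p t (∫ x in t..s, g x) ≤ E s - E t := by
  filter_upwards [h, ae_restrict_mem measurableSet_Ioo] with t ht htab
  exact le_on_Icc_of_ae_le hab ((p t).continuous.comp_continuousOn
    (continuousOn_integral_Icc hab.le hg (Ioo_subset_Icc_self htab))) (hE.sub continuousOn_const) ht

theorem abs_sub_le_of_ae_subgradient_le (hab : a < b) (hg : IntervalIntegrable g volume a b)
    (hE : ContinuousOn E (Icc a b)) (hp : ∀ᵐ t ∂volume.restrict (Ioo a b), ‖p t‖ ≤ M)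
    (h : ∀ᵐ t ∂volume.restrict (Ioo a b), ∀ s ∈ Icc a b,
      p t (∫ x in t..s, g x) ≤ E s - E t) {s t : ℝ} (hs : s ∈ Icc a b) (ht : t ∈ Icc a b) :
    |E s - E t| ≤ M * |∫ x in s..t, ‖g x‖| := by
  have hbound {s : ℝ} (hs : s ∈ Icc a b) :
      ∀ t ∈ Icc a b, E t - E s ≤ M * |∫ x in s..t, ‖g x‖| := by
    refine le_on_Icc_of_ae_le hab (hE.sub continuousOn_const)
      ((continuousOn_integral_Icc hab.le hg.norm hs).abs.const_mul M) ?_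
    filter_upwards [h, hp] with t ht hpt
    calc E t - E s ≤ -p t (∫ x in t..s, g x) := by linarith [ht s hs]
      _ ≤ ‖p t‖ * ‖∫ x in t..s, g x‖ := (neg_le_abs _).trans ((p t).le_opNorm (∫ x in t..s, g x))
      _ ≤ M * |∫ x in s..t, ‖g x‖| := by
          rw [intervalIntegral.integral_symm, norm_neg]
          exact mul_le_mul hpt intervalIntegral.norm_integral_le_abs_integral_norm
            (norm_nonneg _) ((norm_nonneg _).trans hpt)
  rw [abs_le]
  have hts := hbound ht s hs
  rw [intervalIntegral.integral_symm, abs_neg] at hts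
  exact ⟨by linarith [hbound hs t ht], hts⟩

theorem absolutelyContinuousOnInterval_of_ae_subgradient_le (hab : a < b)
    (hg : IntervalIntegrable g volume a b) (hE : ContinuousOn E (Icc a b))
    (hp : ∀ᵐ t ∂volume.restrict (Ioo a b), ‖p t‖ ≤ M)
    (h : ∀ᵐ t ∂volume.restrict (Ioo a b), ∀ s ∈ Icc a b,
      p t (∫ x in t..s, g x) ≤ E s - E t) : AbsolutelyContinuousOnInterval E a b := by
  refine absolutelyContinuousOnInterval_of_dist_le (K := M)
    (hg.norm.absolutelyContinuousOnInterval_intervalIntegral left_mem_uIcc) fun s hs t ht => ?_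
  have hsub (r : ℝ) (hr : r ∈ uIcc a b) : IntervalIntegrable (fun x => ‖g x‖) volume a r :=
    hg.norm.mono_set (uIcc_subset_uIcc_left hr)
  rw [Real.dist_eq, Real.dist_eq, abs_sub_comm (∫ x in a..s, ‖g x‖),
    intervalIntegral.integral_interval_sub_left (hsub t ht) (hsub s hs)]
  rw [uIcc_of_le hab.le] at hs ht
  exact abs_sub_le_of_ae_subgradient_le hab hg hE hp h hs ht

theorem ae_hasDerivAt_of_ae_subgradient_le [CompleteSpace F]
    (hg : IntervalIntegrable g volume a b) (hE : AbsolutelyContinuousOnInterval E a b)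
    (h : ∀ᵐ t ∂volume.restrict (Ioo a b), ∀ s ∈ Icc a b,
      p t (∫ x in t..s, g x) ≤ E s - E t) :
    ∀ᵐ t ∂volume.restrict (Ioo a b), HasDerivAt E (p t (g t)) t := by
  filter_upwards [h, ae_restrict_of_ae hE.ae_differentiableAt,
    ae_restrict_of_ae hg.ae_hasDerivAt_integral, ae_restrict_mem measurableSet_Ioo]
    with t ht hEt hgt htab
  have htab' : t ∈ uIcc a b := Icc_subset_uIcc (Ioo_subset_Icc_self htab)
  have hmin : IsLocalMin (fun s => E s - p t (∫ x in t..s, g x)) t := by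
    filter_upwards [Icc_mem_nhds htab.1 htab.2] with s hs
    rw [intervalIntegral.integral_same, map_zero]
    linarith [ht s hs]
  have hpg : HasDerivAt (fun s => p t (∫ x in t..s, g x)) (p t (g t)) t :=
    (p t).hasFDerivAt.comp_hasDerivAt t (hgt htab' t htab')
  have hEd := (hEt htab').hasDerivAt
  rwa [sub_eq_zero.1 (hmin.hasDerivAt_eq_zero (hEd.sub hpg))] at hEd

/-- Here `E` is meant to be the value of a convex functional along a path with derivative `g`, and
`p t` a subgradient of that functional at the point reached at time `t`. -/
theorem sub_eq_integral_of_ae_subgradient_le [CompleteSpace F] (hab : a < b)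
    (hg : IntervalIntegrable g volume a b) (hE : ContinuousOn E (Icc a b))
    (hp : ∀ᵐ t ∂volume.restrict (Ioo a b), ‖p t‖ ≤ M)
    (h : ∀ᵐ t ∂volume.restrict (Ioo a b), ∀ᵐ s ∂volume.restrict (Ioo a b),
      p t (∫ x in t..s, g x) ≤ E s - E t) {t : ℝ} (ht : t ∈ Icc a b) :
    E t - E a = ∫ s in a..t, p s (g s) := by
  have h' := ae_subgradient_le_of_ae_ae hab hg hE h
  have hEac := absolutelyContinuousOnInterval_of_ae_subgradient_le hab hg hE hp h'
  have hderiv := ae_hasDerivAt_of_ae_subgradient_le hg hEac h'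
  rw [restrict_Ioo_eq_restrict_Icc, ae_restrict_iff' measurableSet_Icc, ← uIcc_of_le hab.le]
    at hderiv
  have hsub : uIcc a t ⊆ uIcc a b := uIcc_subset_uIcc_left (by rwa [uIcc_of_le hab.le])
  exact (integral_eq_sub_of_ae_hasDerivAt (hEac.mono hsub)
    (hderiv.mono fun s hs hst => hs (hsub hst))).symm

end Subgradient

/-! ### Primitives of locally integrable functions on the line -/

section Primitive

/-- `w` is a primitive of the locally integrable function `g` on the whole line. This is the
notion satisfied by the absolutely continuous representative of an element of `H¹(ℝ)`. -/
structure IsPrimitive (w g : ℝ → ℝ) : Prop where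
  locallyIntegrable : LocallyIntegrable g
  sub_eq_integral : ∀ a b, w b - w a = ∫ x in a..b, g x

variable {w g w₁ w₂ g₁ g₂ : ℝ → ℝ}

theorem intervalIntegrable_of_locallyIntegrable (hg : LocallyIntegrable g) (a b : ℝ) :
    IntervalIntegrable g volume a b :=
  intervalIntegrable_iff.2 ((hg.integrableOn_isCompact isCompact_uIcc).mono_set uIoc_subset_uIcc)

theorem isPrimitive_const_add_integral (hg : LocallyIntegrable g) (c s : ℝ) :
    IsPrimitive (fun t => c + ∫ x in s..t, g x) g where
  locallyIntegrable := hg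
  sub_eq_integral a b := by
    rw [add_sub_add_left_eq_sub]
    exact intervalIntegral.integral_interval_sub_left
      (intervalIntegrable_of_locallyIntegrable hg s b)
      (intervalIntegrable_of_locallyIntegrable hg s a)

namespace IsPrimitive

theorem absolutelyContinuousOnInterval (h : IsPrimitive w g) (a b : ℝ) :
    AbsolutelyContinuousOnInterval w a b :=
  absolutelyContinuousOnInterval_of_dist_le (K := 1)
    ((intervalIntegrable_of_locallyIntegrable h.locallyIntegrable a b)
      |>.absolutelyContinuousOnInterval_intervalIntegral left_mem_uIcc)
    fun s _ t _ => by
      simp only [← h.sub_eq_integral, Real.dist_eq, sub_sub_sub_cancel_right, one_mul, le_refl]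

theorem continuous (h : IsPrimitive w g) : Continuous w := by
  refine continuous_iff_continuousAt.2 fun x => ?_
  have hx := (h.absolutelyContinuousOnInterval (x - 1) (x + 1)).continuousOn
  rw [uIcc_of_le (by linarith)] at hx
  exact hx.continuousAt (Icc_mem_nhds (by linarith) (by linarith))

theorem ae_hasDerivAt (h : IsPrimitive w g) : ∀ᵐ x, HasDerivAt w (g x) x := by
  filter_upwards [LocallyIntegrable.ae_hasDerivAt_integral h.locallyIntegrable] with x hx
  simpa only [← h.sub_eq_integral, add_sub_cancel] using (hx 0).const_add (w 0)

theorem mul (h₁ : IsPrimitive w₁ g₁) (h₂ : IsPrimitive w₂ g₂) :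
    IsPrimitive (fun x => w₁ x * w₂ x) fun x => g₁ x * w₂ x + w₁ x * g₂ x where
  locallyIntegrable := (h₁.locallyIntegrable.mul_continuous h₂.continuous).add
    (h₂.locallyIntegrable.continuous_mul h₁.continuous)
  sub_eq_integral a b :=
    (integral_eq_sub_of_ae_hasDerivAt ((h₁.absolutelyContinuousOnInterval a b).fun_mul
      (h₂.absolutelyContinuousOnInterval a b)) (by
        filter_upwards [h₁.ae_hasDerivAt, h₂.ae_hasDerivAt] with x hx₁ hx₂ _
        exact hx₁.mul hx₂)).symm

theorem eq_add_integral (h : IsPrimitive w g) (a x : ℝ) : w x = w a + ∫ s in a..x, g s := by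
  rw [← h.sub_eq_integral, add_sub_cancel]

theorem tendsto_atTop_zero (h : IsPrimitive w g) (hw : Integrable w) (hg : Integrable g) :
    Tendsto w atTop (𝓝 0) := by
  have hlim : Tendsto w atTop (𝓝 (w 0 + ∫ x in Ioi 0, g x)) :=
    ((intervalIntegral_tendsto_integral_Ioi 0 hg.integrableOn tendsto_id).const_add _).congr
      fun x => (h.eq_add_integral 0 x).symm
  have hzero := IntegrableAtFilter.eq_zero_of_tendsto (hw.integrableAtFilter atTop)
    (fun s hs => ?_) hlim
  · rwa [hzero] at hlim
  · obtain ⟨b, hb⟩ := mem_atTop_sets.1 hs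
    exact top_le_iff.1 (Real.volume_Ici (a := b) ▸ measure_mono hb)

theorem tendsto_atBot_zero (h : IsPrimitive w g) (hw : Integrable w) (hg : Integrable g) :
    Tendsto w atBot (𝓝 0) := by
  have hneg : IsPrimitive (fun x => w (-x)) fun x => -g (-x) :=
    ⟨hg.comp_neg.neg.locallyIntegrable, fun a b => by
      rw [intervalIntegral.integral_neg, intervalIntegral.integral_comp_neg,
        ← intervalIntegral.integral_symm, h.sub_eq_integral]⟩
  simpa only [Function.comp_def, neg_neg] using
    (hneg.tendsto_atTop_zero hw.comp_neg hg.comp_neg.neg).comp tendsto_neg_atBot_atTop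

theorem integral_eq_zero (h : IsPrimitive w g) (hw : Integrable w) (hg : Integrable g) :
    ∫ x, g x = 0 := by
  have hlim : Tendsto (fun R : ℝ => w R - w (-R)) atTop (𝓝 (0 - 0)) :=
    (h.tendsto_atTop_zero hw hg).sub
      ((h.tendsto_atBot_zero hw hg).comp tendsto_neg_atTop_atBot)
  simp only [h.sub_eq_integral, sub_zero] at hlim
  exact tendsto_nhds_unique
    (intervalIntegral_tendsto_integral hg tendsto_neg_atTop_atBot tendsto_id) hlim

theorem abs_le_integral_abs (h : IsPrimitive w g) (hw : Integrable w) (hg : Integrable g)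
    (x : ℝ) : |w x| ≤ ∫ s, |g s| := by
  have hlim : Tendsto (fun a => |w x - w a|) atBot (𝓝 |w x - 0|) :=
    ((h.tendsto_atBot_zero hw hg).const_sub _).abs
  rw [sub_zero] at hlim
  refine le_of_tendsto' hlim fun a => ?_
  rw [h.sub_eq_integral]
  exact intervalIntegral.norm_integral_le_integral_norm_uIoc.trans
    (setIntegral_le_integral hg.norm (ae_of_all _ fun s => norm_nonneg (g s)))

end IsPrimitive

end Primitive

/-! ### Sobolev embedding and the convection term -/

section Sobolev

theorem norm_sq_V (v : V) : ‖v‖ ^ 2 = ‖toH v‖ ^ 2 + ‖dx v‖ ^ 2 :=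
  WithLp.prod_norm_sq_eq_of_L2 (v : WithLp 2 (H × H))

theorem norm_toH_le (v : V) : ‖toH v‖ ≤ ‖v‖ :=
  le_of_sq_le_sq (by rw [norm_sq_V]; exact le_add_of_nonneg_right (sq_nonneg _)) (norm_nonneg _)

theorem norm_dx_le (v : V) : ‖dx v‖ ≤ ‖v‖ :=
  le_of_sq_le_sq (by rw [norm_sq_V]; exact le_add_of_nonneg_left (sq_nonneg _)) (norm_nonneg _)

theorem two_mul_norm_toH_mul_norm_dx_le (v : V) : 2 * (‖toH v‖ * ‖dx v‖) ≤ ‖v‖ ^ 2 := by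
  rw [norm_sq_V, ← mul_assoc]
  exact two_mul_le_add_sq _ _

theorem inner_eq_integral (f g : H) : inner ℝ f g = ∫ x, f x * g x := by
  rw [L2.inner_def]
  exact integral_congr_ae (.of_forall fun x => mul_comm _ _)

theorem integrable_mul_H (f g : H) : Integrable (fun x => f x * g x) :=
  (Lp.memLp f).integrable_mul (Lp.memLp g)

theorem integrable_sq_H (f : H) : Integrable (fun x => f x ^ 2) :=
  (Lp.memLp f).integrable_sq

theorem norm_sq_eq_integral (f : H) : ‖f‖ ^ 2 = ∫ x, f x ^ 2 := by
  rw [← real_inner_self_eq_norm_sq, inner_eq_integral]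
  simp only [sq]

theorem integral_abs_mul_le (f g : H) : ∫ x, |f x * g x| ≤ ‖f‖ * ‖g‖ := by
  have h := real_inner_le_norm |f| |g|
  rw [norm_abs_eq_norm, norm_abs_eq_norm, inner_eq_integral] at h
  refine le_of_eq_of_le (integral_congr_ae ?_) h
  filter_upwards [Lp.coeFn_abs f, Lp.coeFn_abs g] with x hf hg
  rw [hf, hg, abs_mul]

theorem hasWeakDerivOn_V (v : V) : HasWeakDerivOn univ (toH v) (dx v) := v.2

theorem exists_representative (v : V) :
    ∃ w, toH v =ᵐ[volume] w ∧ IsPrimitive w (dx v) := by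
  have hg := locallyIntegrable_H (dx v)
  obtain ⟨G, hG, h⟩ := (hasWeakDerivOn_V v).exists_ae_sub_eq_integral isOpen_univ ordConnected_univ
    (by simpa only [indicator_univ] using locallyIntegrable_H (toH v))
    (by simpa only [indicator_univ] using hg)
  obtain ⟨s, hs⟩ := hG.exists
  refine ⟨_, ?_, isPrimitive_const_add_integral hg (toH v s) s⟩
  filter_upwards [hG] with t ht
  exact sub_eq_iff_eq_add'.1 (h s ⟨hs, trivial⟩ t ⟨ht, trivial⟩)

theorem agmon_ae_sq_le (v : V) : ∀ᵐ x, toH v x ^ 2 ≤ 2 * (‖toH v‖ * ‖dx v‖) := by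
  obtain ⟨w, hvw, hw⟩ := exists_representative v
  have hdw : (fun x => 2 * (toH v x * dx v x)) =ᵐ[volume]
      fun x => dx v x * w x + w x * dx v x := by
    filter_upwards [hvw] with x hx
    rw [hx]
    ring
  have hw2 : Integrable fun x => w x * w x :=
    (integrable_mul_H (toH v) (toH v)).congr (hvw.mul hvw)
  have hdw_int := ((integrable_mul_H (toH v) (dx v)).const_mul 2).congr hdw
  filter_upwards [hvw] with x hx
  calc toH v x ^ 2 ≤ |w x * w x| := by rw [hx, sq]; exact le_abs_self _
    _ ≤ ∫ x, |dx v x * w x + w x * dx v x| := (hw.mul hw).abs_le_integral_abs hw2 hdw_int x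
    _ = 2 * ∫ x, |toH v x * dx v x| := by
        rw [← integral_const_mul]
        refine integral_congr_ae (hdw.mono fun x hx => ?_)
        simp only [← hx, abs_mul, Nat.abs_ofNat]
    _ ≤ 2 * (‖toH v‖ * ‖dx v‖) := by gcongr; exact integral_abs_mul_le _ _

theorem ae_abs_le_norm (v : V) : ∀ᵐ x, |toH v x| ≤ ‖v‖ := by
  filter_upwards [agmon_ae_sq_le v] with x hx
  exact abs_le_of_sq_le_sq (hx.trans (two_mul_norm_toH_mul_norm_dx_le v)) (norm_nonneg v)

theorem memLp_convection (v : V) : MemLp (fun x => toH v x * dx v x) 2 := by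
  refine MemLp.of_le_mul (c := ‖v‖) (Lp.memLp (dx v))
    ((Lp.aestronglyMeasurable _).mul (Lp.aestronglyMeasurable _)) ?_
  filter_upwards [ae_abs_le_norm v] with x hx
  rw [norm_mul]
  exact mul_le_mul_of_nonneg_right hx (norm_nonneg _)

/-- The convection term `v ∂ₓv` of the Burgers equation, which for `v ∈ V` lies in `L²(ℝ)` because
`v` is essentially bounded. -/
def convection (v : V) : H := (memLp_convection v).toLp

theorem coeFn_convection (v : V) : convection v =ᵐ[volume] fun x => toH v x * dx v x :=
  (memLp_convection v).coeFn_toLp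

theorem inner_convection (v : V) (f : H) :
    inner ℝ (convection v) f = ∫ x, (toH v x * dx v x) * f x := by
  rw [inner_eq_integral]
  exact integral_congr_ae ((coeFn_convection v).mul (ae_eq_refl f))

theorem norm_convection_sq_le (v : V) :
    ‖convection v‖ ^ 2 ≤ 2 * (‖toH v‖ * ‖dx v‖) * ‖dx v‖ ^ 2 := by
  rw [norm_sq_eq_integral, norm_sq_eq_integral (dx v), ← integral_const_mul]
  refine integral_mono_ae (integrable_sq_H _) ((integrable_sq_H _).const_mul _) ?_
  filter_upwards [agmon_ae_sq_le v, coeFn_convection v] with x hagmon hconv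
  rw [hconv, mul_pow]
  exact mul_le_mul_of_nonneg_right hagmon (sq_nonneg _)

theorem abs_inner_convection_le (v φ : V) :
    |inner ℝ (convection v) (toH φ)| ≤ ‖toH v‖ * ‖dx v‖ * ‖φ‖ := by
  have hint : Integrable fun x => toH v x * dx v x * toH φ x :=
    (integrable_mul_H (convection v) (toH φ)).congr
      ((coeFn_convection v).mul (ae_eq_refl (toH φ)))
  rw [inner_convection]
  calc |∫ x, toH v x * dx v x * toH φ x|
      ≤ ∫ x, |toH v x * dx v x * toH φ x| := abs_integral_le_integral_abs
    _ ≤ ∫ x, |toH v x * dx v x| * ‖φ‖ := by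
        refine integral_mono_ae hint.abs ((integrable_mul_H _ _).abs.mul_const _) ?_
        filter_upwards [ae_abs_le_norm φ] with x hx
        rw [abs_mul]
        exact mul_le_mul_of_nonneg_left hx (abs_nonneg _)
    _ ≤ ‖toH v‖ * ‖dx v‖ * ‖φ‖ := by
        rw [integral_mul_const]
        exact mul_le_mul_of_nonneg_right (integral_abs_mul_le _ _) (norm_nonneg _)

theorem inner_convection_self (v : V) : inner ℝ (convection v) (toH v) = 0 := by
  obtain ⟨w, hvw, hw⟩ := exists_representative v
  have hderiv : (fun x => 3 * (convection v x * toH v x)) =ᵐ[volume]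
      fun x => (dx v x * w x + w x * dx v x) * w x + w x * w x * dx v x := by
    filter_upwards [hvw, coeFn_convection v] with x hx hconv
    rw [hconv, hx]
    ring
  have hw3 : Integrable fun x => w x * w x * w x :=
    ((integrable_mul_H (toH v) (toH v)).congr (hvw.mul hvw)).mul_bdd (c := ‖v‖)
      hw.continuous.aestronglyMeasurable (by
        filter_upwards [hvw, ae_abs_le_norm v] with x hx hbound
        rwa [← hx])
  have hzero := ((hw.mul hw).mul hw).integral_eq_zero hw3
    (((integrable_mul_H (convection v) (toH v)).const_mul 3).congr hderiv)
  rw [← integral_congr_ae hderiv, integral_const_mul] at hzero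
  rw [inner_eq_integral]
  exact (mul_eq_zero.1 hzero).resolve_left three_ne_zero

end Sobolev

/-! ### Translations and difference quotients -/

section Translation

theorem eLpNorm_integral_add_le {F : Type*} [NormedAddCommGroup F] [NormedSpace ℝ F]
    (P : Measure ℝ) [IsProbabilityMeasure P] {p : NNReal} (hp : 1 ≤ p) {g : ℝ → F}
    (hg : StronglyMeasurable g) :
    eLpNorm (fun x => ∫ s, g (x + s) ∂P) p volume ≤ eLpNorm g p volume := by
  have hp0 : p ≠ 0 := (one_pos.trans_le hp).ne'
  have hsum : StronglyMeasurable fun z : ℝ × ℝ => g (z.1 + z.2) :=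
    hg.comp_measurable (measurable_fst.add measurable_snd)
  have jensen (x : ℝ) : ‖∫ s, g (x + s) ∂P‖ₑ ^ (p : ℝ) ≤ ∫⁻ s, ‖g (x + s)‖ₑ ^ (p : ℝ) ∂P := by
    rw [← eLpNorm_nnreal_pow_eq_lintegral hp0]
    gcongr
    calc ‖∫ s, g (x + s) ∂P‖ₑ ≤ eLpNorm (fun s => g (x + s)) 1 P := by
          rw [eLpNorm_one_eq_lintegral_enorm]
          exact enorm_integral_le_lintegral_enorm _
      _ ≤ eLpNorm (fun s => g (x + s)) p P :=
          eLpNorm_le_eLpNorm_of_exponent_le (by exact_mod_cast hp)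
            (hg.comp_measurable (measurable_const_add x)).aestronglyMeasurable
  rw [← ENNReal.rpow_le_rpow_iff (NNReal.coe_pos.2 (one_pos.trans_le hp)),
    eLpNorm_nnreal_pow_eq_lintegral hp0, eLpNorm_nnreal_pow_eq_lintegral hp0]
  calc ∫⁻ x, ‖∫ s, g (x + s) ∂P‖ₑ ^ (p : ℝ)
      ≤ ∫⁻ x, ∫⁻ s, ‖g (x + s)‖ₑ ^ (p : ℝ) ∂P := lintegral_mono jensen
    _ = ∫⁻ s, ∫⁻ x, ‖g (x + s)‖ₑ ^ (p : ℝ) ∂volume ∂P :=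
        lintegral_lintegral_swap (f := fun x s => ‖g (x + s)‖ₑ ^ (p : ℝ))
          (hsum.enorm.pow_const _).aemeasurable
    _ = ∫⁻ _s, ∫⁻ x, ‖g x‖ₑ ^ (p : ℝ) ∂volume ∂P :=
        lintegral_congr fun s => lintegral_add_right_eq_self (fun x => ‖g x‖ₑ ^ (p : ℝ)) s
    _ = ∫⁻ x, ‖g x‖ₑ ^ (p : ℝ) := by rw [lintegral_const, measure_univ, mul_one]

/-- Translation by `h` on `L²(ℝ)`, that is `f ↦ f(· + h)`. -/
def shift (h : ℝ) : H →ₗᵢ[ℝ] H :=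
  Lp.compMeasurePreservingₗᵢ ℝ (fun x => x + h) (measurePreserving_add_right volume h)

theorem coeFn_shift (h : ℝ) (f : H) : shift h f =ᵐ[volume] fun x => f (x + h) :=
  Lp.coeFn_compMeasurePreserving f (measurePreserving_add_right volume h)

theorem shift_shift_neg (h : ℝ) (f : H) : shift h (shift (-h) f) = f := by
  refine Lp.ext ?_
  filter_upwards [coeFn_shift h (shift (-h) f), (measurePreserving_add_right volume h)
    |>.quasiMeasurePreserving.ae (coeFn_shift (-h) f)] with x hx hxh
  rw [hx, hxh, add_neg_cancel_right]

theorem inner_shift (h : ℝ) (f g : H) : inner ℝ (shift h f) g = inner ℝ f (shift (-h) g) := by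
  rw [← (shift h).inner_map_map f, shift_shift_neg]

theorem integral_smul_shift (a : ℝ → ℝ) (h : ℝ) (f : H) :
    ∫ x, a x • shift h f x = ∫ x, a (x - h) • f x := by
  rw [← integral_add_right_eq_self (fun x => a (x - h) • f x) h]
  refine integral_congr_ae ((coeFn_shift h f).mono fun x hx => ?_)
  simp only [hx, add_sub_cancel_right]

theorem shift_mem_H1 (h : ℝ) (v : V) :
    WithLp.toLp 2 (shift h (toH v), shift h (dx v)) ∈ H1 := by
  refine ⟨(locallyIntegrable_H _).locallyIntegrableOn _,
    (locallyIntegrable_H _).locallyIntegrableOn _, fun φ hφ hc _ => ?_⟩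
  have hweak := (hasWeakDerivOn_V v).2.2 (fun x => φ (x - h))
    (hφ.comp (contDiff_id.sub contDiff_const))
    (hc.comp_homeomorph (Homeomorph.subRight h)) (subset_univ _)
  simp only [deriv_comp_sub_const, Measure.restrict_univ] at hweak
  rw [Measure.restrict_univ]
  exact (integral_smul_shift _ h (toH v)).trans
    (hweak.trans (congrArg Neg.neg (integral_smul_shift _ h (dx v)).symm))

/-- Translation by `h` on `H¹(ℝ)`. -/
def shiftV (h : ℝ) : V →L[ℝ] V :=
  LinearMap.mkContinuous
    { toFun := fun v => ⟨WithLp.toLp 2 (shift h (toH v), shift h (dx v)), shift_mem_H1 h v⟩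
      map_add' := fun v w => by
        ext1
        simp only [map_add]
        rfl
      map_smul' := fun c v => by
        ext1
        simp only [map_smul]
        rfl } 1 fun v => by
    rw [one_mul]
    refine le_of_sq_le_sq (le_of_eq ?_) (norm_nonneg _)
    rw [norm_sq_V v, ← (shift h).norm_map (toH v), ← (shift h).norm_map (dx v)]
    exact WithLp.prod_norm_sq_eq_of_L2 _

theorem toH_shiftV (h : ℝ) (v : V) : toH (shiftV h v) = shift h (toH v) := rfl

theorem dx_shiftV (h : ℝ) (v : V) : dx (shiftV h v) = shift h (dx v) := rfl

/-- The difference quotient `f ↦ (f(· + h) - f) / h` on `L²(ℝ)`; it is `0` for `h = 0`. -/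
def diffQuot (h : ℝ) : H →L[ℝ] H := h⁻¹ • ((shift h).toContinuousLinearMap - .id ℝ H)

/-- The difference quotient `v ↦ (v(· + h) - v) / h` on `H¹(ℝ)`; it is `0` for `h = 0`. -/
def diffQuotV (h : ℝ) : V →L[ℝ] V := h⁻¹ • (shiftV h - .id ℝ V)

/-- The operator `D_h^* D_h` on `H¹(ℝ)`, with `D_h` the difference quotient. Testing the equation
with `D_h^* D_h y` is the substitute for testing it with `-∂ₓₓy`, which is not in `V`. -/
def adjointDiffQuotV (h : ℝ) : V →L[ℝ] V := -(diffQuotV (-h)).comp (diffQuotV h)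

theorem diffQuot_apply (h : ℝ) (f : H) : diffQuot h f = h⁻¹ • (shift h f - f) := rfl

theorem toH_diffQuotV (h : ℝ) (v : V) : toH (diffQuotV h v) = diffQuot h (toH v) := by
  simp [diffQuotV, diffQuot_apply, toH_shiftV]

theorem dx_diffQuotV (h : ℝ) (v : V) : dx (diffQuotV h v) = diffQuot h (dx v) := by
  simp [diffQuotV, diffQuot_apply, dx_shiftV]

theorem toH_adjointDiffQuotV (h : ℝ) (v : V) :
    toH (adjointDiffQuotV h v) = -diffQuot (-h) (diffQuot h (toH v)) := by
  simp [adjointDiffQuotV, toH_diffQuotV]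

theorem dx_adjointDiffQuotV (h : ℝ) (v : V) :
    dx (adjointDiffQuotV h v) = -diffQuot (-h) (diffQuot h (dx v)) := by
  simp [adjointDiffQuotV, dx_diffQuotV]

theorem inner_diffQuot (h : ℝ) (f g : H) :
    inner ℝ (diffQuot h f) g = -inner ℝ f (diffQuot (-h) g) := by
  simp only [diffQuot_apply, real_inner_smul_left, real_inner_smul_right, inner_sub_left,
    inner_sub_right, inner_shift, inv_neg, neg_mul, neg_neg]

theorem inner_diffQuot_diffQuot (h : ℝ) (f : H) (v : V) :
    inner ℝ (diffQuot h f) (diffQuot h (toH v)) = inner ℝ f (toH (adjointDiffQuotV h v)) := by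
  rw [inner_diffQuot, toH_adjointDiffQuotV, inner_neg_right]

theorem inner_dx_adjointDiffQuotV (h : ℝ) (v : V) :
    inner ℝ (dx v) (dx (adjointDiffQuotV h v)) = ‖diffQuot h (dx v)‖ ^ 2 := by
  rw [dx_adjointDiffQuotV, inner_neg_right, ← inner_diffQuot, real_inner_self_eq_norm_sq]

theorem coeFn_diffQuot_of_ae_eq {f : H} {w : ℝ → ℝ} (hw : f =ᵐ[volume] w) (h : ℝ) :
    diffQuot h f =ᵐ[volume] fun x => h⁻¹ • (w (x + h) - w x) := by
  filter_upwards [Lp.coeFn_smul h⁻¹ (shift h f - f), Lp.coeFn_sub (shift h f) f, coeFn_shift h f,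
    hw, (measurePreserving_add_right volume h).quasiMeasurePreserving.ae hw]
    with x hsmul hsub hshift hx hxh
  rw [diffQuot_apply, hsmul, Pi.smul_apply, hsub, Pi.sub_apply, hshift, hx, hxh]

theorem coeFn_diffQuot_toH (h : ℝ) (v : V) :
    diffQuot h (toH v) =ᵐ[volume] fun x => ⨍ s in 0..h, dx v (x + s) := by
  obtain ⟨w, hvw, hw⟩ := exists_representative v
  filter_upwards [coeFn_diffQuot_of_ae_eq hvw h] with x hx
  rw [hx, hw.sub_eq_integral, interval_average_eq,
    intervalIntegral.integral_comp_add_left (fun s => dx v s), add_zero, sub_zero]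

theorem norm_diffQuot_toH_le {h : ℝ} (hh : h ≠ 0) (v : V) : ‖diffQuot h (toH v)‖ ≤ ‖dx v‖ := by
  have : IsFiniteMeasure (volume.restrict (uIoc 0 h)) := by
    unfold uIoc
    infer_instance
  have : NeZero (volume.restrict (uIoc 0 h)) := ⟨by
    rw [Ne, Measure.restrict_eq_zero, Real.volume_uIoc, sub_zero, ENNReal.ofReal_eq_zero, not_le]
    exact abs_pos.2 hh⟩
  rw [Lp.norm_def, Lp.norm_def, ENNReal.toReal_le_toReal (Lp.eLpNorm_ne_top _)
    (Lp.eLpNorm_ne_top _), eLpNorm_congr_ae (coeFn_diffQuot_toH h v)]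
  exact eLpNorm_integral_add_le _ one_le_two (Lp.stronglyMeasurable (dx v))

theorem norm_toH_adjointDiffQuotV_le {h : ℝ} (hh : h ≠ 0) (v : V) :
    ‖toH (adjointDiffQuotV h v)‖ ≤ ‖diffQuot h (dx v)‖ := by
  rw [toH_adjointDiffQuotV, norm_neg, ← toH_diffQuotV, ← dx_diffQuotV]
  exact norm_diffQuot_toH_le (neg_ne_zero.2 hh) _

theorem norm_dx_le_of_norm_diffQuot_le {v : V} {K : ℝ}
    (hK : ∀ h ≠ 0, ‖diffQuot h (toH v)‖ ≤ K) : ‖dx v‖ ≤ K := by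
  obtain ⟨h, hh⟩ := exists_seq_tendsto (𝓝[≠] (0 : ℝ))
  obtain ⟨w, hvw, hw⟩ := exists_representative v
  have hlim : ∀ᵐ x, Tendsto (fun n => diffQuot (h n) (toH v) x) atTop (𝓝 (dx v x)) := by
    filter_upwards [ae_all_iff.2 fun n => coeFn_diffQuot_of_ae_eq hvw (h n), hw.ae_hasDerivAt]
      with x hx hderiv
    exact (hderiv.tendsto_slope_zero.comp hh).congr fun n => (hx n).symm
  have hK0 : 0 ≤ K := (norm_nonneg _).trans (hK 1 one_ne_zero)
  rw [← ENNReal.ofReal_le_ofReal_iff hK0, ofReal_norm, Lp.enorm_def]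
  calc eLpNorm (dx v) 2 volume
      ≤ liminf (fun n => eLpNorm (diffQuot (h n) (toH v)) 2 volume) atTop :=
        Lp.eLpNorm_lim_le_liminf_eLpNorm (fun n => Lp.aestronglyMeasurable _) _ hlim
    _ ≤ liminf (fun _ : ℕ => ENNReal.ofReal K) atTop := by
        refine liminf_le_liminf ((hh.eventually self_mem_nhdsWithin).mono fun n hn => ?_)
        rw [← Lp.enorm_def, ← ofReal_norm]
        exact ENNReal.ofReal_le_ofReal (hK (h n) hn)
    _ = ENNReal.ofReal K := liminf_const _

end Translation

/-! ### The equation in the dual space -/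

-- Without this shortcut, `ContinuousENorm VDual` is not synthesized.
instance : NormedAddCommGroup VDual := ContinuousLinearMap.toNormedAddCommGroup

section BurgersField

variable {ν : ℝ}

/-- The element `g - v ∂ₓv + ν ∂ₓₓv` of `V*`, the right-hand side of the Burgers equation with
forcing `g` solved for the time derivative. -/
def burgersField (ν : ℝ) (g : H) (v : V) : VDual :=
  (innerSL ℝ (g - convection v)).comp toH - ν • (innerSL ℝ (dx v)).comp dx

theorem burgersField_apply (ν : ℝ) (g : H) (v φ : V) : burgersField ν g v φ =
    inner ℝ g (toH φ) - inner ℝ (convection v) (toH φ) - ν * inner ℝ (dx v) (dx φ) := by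
  simp [burgersField]

theorem norm_burgersField_le (hν : 0 ≤ ν) (g : H) (v : V) :
    ‖burgersField ν g v‖ ≤ ‖g‖ + ‖toH v‖ * ‖dx v‖ + ν * ‖dx v‖ := by
  refine ContinuousLinearMap.opNorm_le_bound _ (by positivity) fun φ => ?_
  have hforce : |inner ℝ g (toH φ)| ≤ ‖g‖ * ‖φ‖ :=
    (abs_real_inner_le_norm _ _).trans (by gcongr; exact norm_toH_le φ)
  have hviscous : |ν * inner ℝ (dx v) (dx φ)| ≤ ν * (‖dx v‖ * ‖φ‖) := by
    rw [abs_mul, abs_of_nonneg hν]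
    gcongr
    exact (abs_real_inner_le_norm _ _).trans (by gcongr; exact norm_dx_le φ)
  rw [burgersField_apply, Real.norm_eq_abs]
  calc _ ≤ |inner ℝ g (toH φ)| + |inner ℝ (convection v) (toH φ)|
        + |ν * inner ℝ (dx v) (dx φ)| :=
        (abs_sub _ _).trans (by gcongr; exact abs_sub _ _)
    _ ≤ ‖g‖ * ‖φ‖ + ‖toH v‖ * ‖dx v‖ * ‖φ‖ + ν * (‖dx v‖ * ‖φ‖) :=
        add_le_add (add_le_add hforce (abs_inner_convection_le v φ)) hviscous
    _ = (‖g‖ + ‖toH v‖ * ‖dx v‖ + ν * ‖dx v‖) * ‖φ‖ := by ring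

theorem two_mul_burgersField_self_le (ν : ℝ) (g : H) (v : V) :
    2 * burgersField ν g v v ≤ ‖g‖ ^ 2 + ‖toH v‖ ^ 2 - 2 * ν * ‖dx v‖ ^ 2 := by
  rw [burgersField_apply, inner_convection_self, real_inner_self_eq_norm_sq]
  linarith [real_inner_le_norm g (toH v), two_mul_le_add_sq ‖g‖ ‖toH v‖]

theorem two_mul_burgersField_adjointDiffQuotV_le (hν : 0 < ν) (g : H) (v : V) {h : ℝ}
    (hh : h ≠ 0) : 2 * burgersField ν g v (adjointDiffQuotV h v)
      ≤ ‖g‖ ^ 2 / ν + 2 / ν * (‖toH v‖ * ‖dx v‖) * ‖dx v‖ ^ 2 := by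
  set q := ‖diffQuot h (dx v)‖
  have hq : ‖toH (adjointDiffQuotV h v)‖ ≤ q := norm_toH_adjointDiffQuotV_le hh v
  have hforce : inner ℝ g (toH (adjointDiffQuotV h v)) ≤ ‖g‖ * q :=
    (real_inner_le_norm _ _).trans (by gcongr)
  have hconv : -inner ℝ (convection v) (toH (adjointDiffQuotV h v)) ≤ ‖convection v‖ * q :=
    (neg_le_abs _).trans ((abs_real_inner_le_norm _ _).trans (by gcongr))
  have habsorb (a : ℝ) : 2 * (a * q) ≤ a ^ 2 / ν + ν * q ^ 2 := by
    have := div_nonneg (sq_nonneg (a - ν * q)) hν.le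
    have hsq : (a - ν * q) ^ 2 / ν = a ^ 2 / ν + ν * q ^ 2 - 2 * (a * q) := by
      field_simp
      ring
    linarith
  calc 2 * burgersField ν g v (adjointDiffQuotV h v)
      ≤ 2 * (‖g‖ * q) + 2 * (‖convection v‖ * q) - 2 * (ν * q ^ 2) := by
        rw [burgersField_apply, inner_dx_adjointDiffQuotV]
        linarith
    _ ≤ ‖g‖ ^ 2 / ν + ‖convection v‖ ^ 2 / ν := by
        linarith [habsorb ‖g‖, habsorb ‖convection v‖]
    _ ≤ ‖g‖ ^ 2 / ν + 2 * (‖toH v‖ * ‖dx v‖) * ‖dx v‖ ^ 2 / ν := by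
        gcongr
        exact norm_convection_sq_le v
    _ = ‖g‖ ^ 2 / ν + 2 / ν * (‖toH v‖ * ‖dx v‖) * ‖dx v‖ ^ 2 := by ring

end BurgersField

section MemW

variable {T : ℝ} {y : ℝ → V} {dy : ℝ → VDual} {z : ℝ → H}

theorem norm_toDual_le (v : V) : ‖toDual v‖ ≤ ‖v‖ :=
  ContinuousLinearMap.opNorm_le_bound _ (norm_nonneg _) fun φ =>
    (norm_inner_le_norm (𝕜 := ℝ) (toH v) (toH φ)).trans
      (mul_le_mul (norm_toH_le v) (norm_toH_le φ) (norm_nonneg _) (norm_nonneg _))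

theorem ae_norm_le_normLp {E : Type*} [NormedAddCommGroup E] {f : ℝ → E}
    (hf : MemLp f ⊤ (timeMeasure T)) : ∀ᵐ t ∂timeMeasure T, ‖f t‖ ≤ normLp ⊤ T f := by
  filter_upwards [ae_le_eLpNormEssSup (f := f) (μ := timeMeasure T)] with t ht
  rw [normLp, ← toReal_enorm]
  exact ENNReal.toReal_mono hf.eLpNorm_ne_top (ht.trans_eq eLpNorm_exponent_top.symm)

theorem MemW.integrableOn_toDual (hW : MemW T y dy) :
    IntegrableOn (fun t => toDual (y t)) (Ioo 0 T) :=
  (MemLp.of_le hW.memLp hW.hasWeakDeriv.1.aestronglyMeasurable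
    (.of_forall fun _ => norm_toDual_le _)).integrable one_le_two

theorem MemW.integrableOn_deriv (hW : MemW T y dy) : IntegrableOn dy (Ioo 0 T) :=
  hW.memLp_deriv.integrable one_le_two

theorem MemW.hasWeakDerivOn_inner (hW : MemW T y dy) (φ : V) :
    HasWeakDerivOn (Ioo 0 T) (fun t => inner ℝ (toH (y t)) (toH φ)) (fun t => dy t φ) :=
  hW.hasWeakDeriv.clm_comp (ContinuousLinearMap.apply ℝ ℝ φ)

theorem MemW.ae_sub_eq_integral (hW : MemW T y dy) :
    ∀ᵐ t ∂timeMeasure T, ∀ᵐ s ∂timeMeasure T,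
      toDual (y s) - toDual (y t) = ∫ x in t..s, dy x := by
  obtain ⟨G, hG, hsub⟩ := hW.hasWeakDeriv.exists_ae_sub_eq_integral isOpen_Ioo ordConnected_Ioo
    ((integrable_indicator_iff measurableSet_Ioo).2 hW.integrableOn_toDual).locallyIntegrable
    ((integrable_indicator_iff measurableSet_Ioo).2 hW.integrableOn_deriv).locallyIntegrable
  have hGT : ∀ᵐ t ∂timeMeasure T, t ∈ G ∩ Ioo 0 T :=
    (ae_restrict_of_ae hG).and (ae_restrict_mem measurableSet_Ioo)
  exact hGT.mono fun t ht => hGT.mono fun s hs => hsub t ht s hs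

theorem two_mul_inner_sub_le {E : Type*} [NormedAddCommGroup E] [InnerProductSpace ℝ E]
    (a b : E) : 2 * inner ℝ (b - a) a ≤ ‖b‖ ^ 2 - ‖a‖ ^ 2 := by
  have h := norm_sub_sq_real b a
  rw [inner_sub_left, real_inner_self_eq_norm_sq]
  linarith [sq_nonneg ‖b - a‖]

theorem MemW.norm_sq_sub_eq_integral (hW : MemW T y dy) (hT : 0 < T)
    (hy : MemLp y ⊤ (timeMeasure T)) (hz : ContinuousOn z (Icc 0 T))
    (hyz : ∀ᵐ t ∂timeMeasure T, toH (y t) = z t) {D : H →L[ℝ] H} {B : V →L[ℝ] V}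
    (hDB : ∀ (f : H) (v : V), inner ℝ (D f) (D (toH v)) = inner ℝ f (toH (B v)))
    {t : ℝ} (ht : t ∈ Icc 0 T) :
    ‖D (z t)‖ ^ 2 - ‖D (z 0)‖ ^ 2 = ∫ s in 0..t, 2 * dy s (B (y s)) := by
  refine sub_eq_integral_of_ae_subgradient_le (F := VDual) (E := fun t => ‖D (z t)‖ ^ 2)
    (M := 2 * (‖B‖ * normLp ⊤ T y))
    (p := fun t => (2 : ℝ) • ContinuousLinearMap.apply ℝ ℝ (B (y t))) hT
    ((intervalIntegrable_iff_integrableOn_Ioo_of_le hT.le).2 hW.integrableOn_deriv)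
    ((D.continuous.comp_continuousOn hz).norm.pow 2) ?_ ?_ ht
  · filter_upwards [ae_norm_le_normLp hy] with s hs
    refine ContinuousLinearMap.opNorm_le_bound _
      (mul_nonneg zero_le_two (mul_nonneg (norm_nonneg B) ENNReal.toReal_nonneg)) fun L => ?_
    calc ‖((2 : ℝ) • ContinuousLinearMap.apply ℝ ℝ (B (y s))) L‖ = 2 * ‖L (B (y s))‖ := by
          simp [norm_mul]
      _ ≤ 2 * (‖L‖ * (‖B‖ * ‖y s‖)) := by
          gcongr
          exact (L.le_opNorm _).trans (by gcongr; exact B.le_opNorm _)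
      _ ≤ 2 * (‖B‖ * normLp ⊤ T y) * ‖L‖ := by
          rw [mul_assoc, mul_comm ‖L‖]
          gcongr
  · filter_upwards [hW.ae_sub_eq_integral, hyz] with t ht hyt
    filter_upwards [ht, hyz] with s hs hys
    rw [← hs]
    have hpair : (toDual (y s) - toDual (y t)) (B (y t))
        = inner ℝ (D (z s) - D (z t)) (D (z t)) := by
      rw [← map_sub, ← hyt, ← hys, hDB, inner_sub_left]
      rfl
    simpa [hpair] using two_mul_inner_sub_le (D (z t)) (D (z s))

end MemW

section Equation

variable {ν T : ℝ} {χ u : ℝ → ℝ} {y₀ : V} {y : ℝ → V} {dy : ℝ → VDual}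

instance : TopologicalSpace.SeparableSpace V := by
  have : Fact ((2 : ENNReal) ≠ ⊤) := ⟨ENNReal.ofNat_ne_top⟩
  have : SecondCountableTopology H := Lp.SecondCountableTopology
  have : SecondCountableTopology (WithLp 2 (H × H)) :=
    (WithLp.homeomorphProd 2 H H).secondCountableTopology
  have : SecondCountableTopology V := TopologicalSpace.Subtype.secondCountableTopology _
  infer_instance

theorem IsWeakSolution.ae_deriv_apply (hsol : IsWeakSolution ν T χ u y₀ y) (hW : MemW T y dy)
    (hχ : MemLp χ 2 volume) (φ : V) :
    ∀ᵐ t ∂timeMeasure T, dy t φ = burgersField ν (u t • hχ.toLp χ) (y t) φ := by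
  obtain ⟨w, hw, heq⟩ := hsol.equation φ
  filter_upwards [heq, hw.ae_eq isOpen_Ioo (hW.hasWeakDerivOn_inner φ)] with t ht hwt
  have hforce : ∫ x, (χ x * u t) * toH φ x = u t * inner ℝ (hχ.toLp χ) (toH φ) := by
    rw [inner_eq_integral, ← integral_const_mul]
    refine integral_congr_ae (hχ.coeFn_toLp.mono fun x hx => ?_)
    simp only [hx]
    ring
  rw [burgersField_apply, inner_convection, real_inner_smul_left, ← hforce, ← ht, ← hwt]
  ring

theorem IsWeakSolution.ae_deriv_eq (hsol : IsWeakSolution ν T χ u y₀ y) (hW : MemW T y dy)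
    (hχ : MemLp χ 2 volume) :
    ∀ᵐ t ∂timeMeasure T, dy t = burgersField ν (u t • hχ.toLp χ) (y t) := by
  obtain ⟨s, hs, hd⟩ := TopologicalSpace.exists_countable_dense V
  filter_upwards [(ae_ball_iff hs).2 fun φ _ => hsol.ae_deriv_apply hW hχ φ] with t ht
  exact DFunLike.coe_injective (Continuous.ext_on hd (dy t).continuous
    (burgersField ν (u t • hχ.toLp χ) (y t)).continuous ht)

end Equation

/-! ### A priori estimates -/

section NormLp

variable {E F : Type*} [NormedAddCommGroup E] [NormedAddCommGroup F] {T c : ℝ} {f : ℝ → E}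
  {g : ℝ → F}

theorem integrableOn_norm_sq (hf : MemLp f 2 (timeMeasure T)) :
    IntegrableOn (fun t => ‖f t‖ ^ 2) (Ioo 0 T) :=
  (memLp_two_iff_integrable_sq_norm hf.1).1 hf

theorem normLp_two_sq (hT : 0 ≤ T) (hf : MemLp f 2 (timeMeasure T)) :
    normLp 2 T f ^ 2 = ∫ t in 0..T, ‖f t‖ ^ 2 := by
  rw [normLp, hf.eLpNorm_eq_integral_rpow_norm two_ne_zero ENNReal.ofNat_ne_top,
    ENNReal.toReal_ofReal (by positivity), intervalIntegral.integral_of_le hT,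
    integral_Ioc_eq_integral_Ioo]
  simp only [ENNReal.toReal_ofNat, Real.rpow_ofNat]
  rw [← Real.rpow_natCast, ← Real.rpow_mul (by positivity)]
  norm_num

theorem integral_norm_sq_le_normLp_sq (hf : MemLp f 2 (timeMeasure T)) {t : ℝ}
    (ht : t ∈ Icc 0 T) : ∫ s in 0..t, ‖f s‖ ^ 2 ≤ normLp 2 T f ^ 2 := by
  rw [normLp_two_sq (ht.1.trans ht.2) hf]
  exact intervalIntegral.integral_mono_interval le_rfl ht.1 ht.2 (.of_forall fun s => sq_nonneg _)
    ((intervalIntegrable_iff_integrableOn_Ioo_of_le (ht.1.trans ht.2)).2 (integrableOn_norm_sq hf))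

theorem normLp_top_le (hc : 0 ≤ c) (h : ∀ᵐ t ∂timeMeasure T, ‖f t‖ ≤ c) : normLp ⊤ T f ≤ c := by
  refine ENNReal.toReal_le_of_le_ofReal hc ?_
  rw [eLpNorm_exponent_top]
  exact eLpNormEssSup_le_of_ae_bound h

theorem normLp_two_const (hT : 0 ≤ T) (hc : 0 ≤ c) : normLp 2 T (fun _ => c) = √T * c := by
  rw [normLp, eLpNorm_const' c two_ne_zero ENNReal.ofNat_ne_top, Measure.restrict_apply_univ,
    Real.volume_Ioo, sub_zero, ENNReal.toReal_mul, ← ENNReal.toReal_rpow, ENNReal.toReal_ofReal hT,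
    ENNReal.toReal_ofNat, ← Real.sqrt_eq_rpow, toReal_enorm, Real.norm_of_nonneg hc, mul_comm]

theorem normLp_two_le_of_ae_norm_le (hT : 0 ≤ T) (hc : 0 ≤ c) (hg : MemLp g 2 (timeMeasure T))
    (h : ∀ᵐ t ∂timeMeasure T, ‖f t‖ ≤ c + ‖g t‖) : normLp 2 T f ≤ √T * c + normLp 2 T g := by
  have hconst : MemLp (fun _ : ℝ => c) 2 (timeMeasure T) := memLp_const c
  calc normLp 2 T f ≤ (eLpNorm (fun _ => c) 2 (timeMeasure T)
        + eLpNorm (fun t => ‖g t‖) 2 (timeMeasure T)).toReal :=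
        ENNReal.toReal_mono (ENNReal.add_ne_top.2 ⟨hconst.eLpNorm_ne_top, hg.norm.eLpNorm_ne_top⟩)
          ((eLpNorm_mono_ae_real h).trans (eLpNorm_add_le hconst.1 hg.norm.1 one_le_two))
    _ = √T * c + normLp 2 T g := by
        rw [ENNReal.toReal_add hconst.eLpNorm_ne_top hg.norm.eLpNorm_ne_top, eLpNorm_norm,
          ← normLp_two_const hT hc]
        rfl

theorem normLp_smul_const [NormedSpace ℝ E] (p : ENNReal) (T : ℝ) (u : ℝ → ℝ) (x : E) :
    normLp p T (fun t => u t • x) = ‖x‖ * normLp p T u := by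
  have hnorm : eLpNorm (fun t => u t • x) p (timeMeasure T)
      = eLpNorm (‖x‖ • u) p (timeMeasure T) :=
    eLpNorm_congr_norm_ae (.of_forall fun t => by simp [norm_smul, mul_comm])
  rw [normLp, hnorm, eLpNorm_const_smul, ENNReal.toReal_mul, enorm_norm, toReal_enorm]
  rfl

theorem normW_le_add (T : ℝ) (y : ℝ → V) (dy : ℝ → VDual) :
    normW T y dy ≤ normLp 2 T y + normLp 2 T dy := by
  have hy : 0 ≤ normLp 2 T y := ENNReal.toReal_nonneg
  have hdy : 0 ≤ normLp 2 T dy := ENNReal.toReal_nonneg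
  refine Real.sqrt_le_iff.2 ⟨add_nonneg hy hdy, ?_⟩
  nlinarith [mul_nonneg hy hdy]

end NormLp

/-- `y` is an `L^∞(0,T;V)` solution of `∂_t y + y ∂ₓy - ν ∂ₓₓy = f`, `y(0) = y₀`, with forcing
`f ∈ L²(0,T;H)` and the equation holding in `V*` at almost every time. Here `dy = ∂_t y`, and `z`
is the representative of `y` in `C([0,T]; H)`. -/
structure IsDualSolution (ν T : ℝ) (f : ℝ → H) (y₀ : V) (y : ℝ → V) (dy : ℝ → VDual)
    (z : ℝ → H) : Prop where
  memLp_forcing : MemLp f 2 (timeMeasure T)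
  memW : MemW T y dy
  memLp_top : MemLp y ⊤ (timeMeasure T)
  continuousOn : ContinuousOn z (Icc 0 T)
  ae_toH_eq : ∀ᵐ t ∂timeMeasure T, toH (y t) = z t
  initial : z 0 = toH y₀
  ae_deriv_eq : ∀ᵐ t ∂timeMeasure T, dy t = burgersField ν (f t) (y t)

/-- Bounds `(2/ν) ∫₀ᵀ ‖y‖_H ‖∂ₓy‖_H dt`, the exponent produced by Gronwall's inequality for
`‖∂ₓy‖_H²`, in units of `‖y₀‖_H² + ‖f‖_{L²(0,T;H)}²`. -/
def transportRate (ν T : ℝ) : ℝ :=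
  (T * Real.exp T + (1 + T * Real.exp T) / (2 * ν)) / ν

theorem transportRate_nonneg {ν T : ℝ} (hν : 0 ≤ ν) (hT : 0 ≤ T) : 0 ≤ transportRate ν T := by
  unfold transportRate
  positivity

section Estimates

variable {ν T : ℝ} {f : ℝ → H} {y₀ : V} {y : ℝ → V} {dy : ℝ → VDual} {z : ℝ → H} {t : ℝ}

theorem intervalIntegrable_norm_pow_mul (hy : MemLp y ⊤ (timeMeasure T)) (i j : ℕ)
    (ht : t ∈ Icc 0 T) :
    IntervalIntegrable (fun s => ‖toH (y s)‖ ^ i * ‖dx (y s)‖ ^ j) volume 0 t := by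
  have hT : IntegrableOn (fun s => ‖toH (y s)‖ ^ i * ‖dx (y s)‖ ^ j) (Ioo 0 T) := by
    refine Integrable.of_bound (C := normLp ⊤ T y ^ i * normLp ⊤ T y ^ j) ?_ ?_
    · exact (by fun_prop : Continuous fun v : V => ‖toH v‖ ^ i * ‖dx v‖ ^ j)
        |>.comp_aestronglyMeasurable hy.1
    · filter_upwards [ae_norm_le_normLp hy] with s hs
      have hM : 0 ≤ normLp ⊤ T y := ENNReal.toReal_nonneg
      rw [Real.norm_of_nonneg (by positivity)]
      gcongr
      exacts [(norm_toH_le _).trans hs, (norm_dx_le _).trans hs]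
  exact (intervalIntegrable_iff_integrableOn_Ioo_of_le ht.1).2
    (hT.mono_set (Ioo_subset_Ioo_right ht.2))

theorem intervalIntegrable_norm_toH_sq (hy : MemLp y ⊤ (timeMeasure T)) (ht : t ∈ Icc 0 T) :
    IntervalIntegrable (fun s => ‖toH (y s)‖ ^ 2) volume 0 t := by
  simpa only [pow_zero, mul_one] using intervalIntegrable_norm_pow_mul hy 2 0 ht

theorem intervalIntegrable_norm_dx_sq (hy : MemLp y ⊤ (timeMeasure T)) (ht : t ∈ Icc 0 T) :
    IntervalIntegrable (fun s => ‖dx (y s)‖ ^ 2) volume 0 t := by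
  simpa only [pow_zero, one_mul] using intervalIntegrable_norm_pow_mul hy 0 2 ht

theorem intervalIntegrable_norm_toH_mul_norm_dx (hy : MemLp y ⊤ (timeMeasure T))
    (ht : t ∈ Icc 0 T) (c : ℝ) :
    IntervalIntegrable (fun s => c * (‖toH (y s)‖ * ‖dx (y s)‖)) volume 0 t := by
  simpa only [pow_one] using (intervalIntegrable_norm_pow_mul hy 1 1 ht).const_mul c

theorem intervalIntegrable_norm_toH_mul_norm_dx_mul_sq (hy : MemLp y ⊤ (timeMeasure T))
    (ht : t ∈ Icc 0 T) (c : ℝ) : IntervalIntegrable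
      (fun s => c * (‖toH (y s)‖ * ‖dx (y s)‖) * ‖dx (y s)‖ ^ 2) volume 0 t := by
  convert (intervalIntegrable_norm_pow_mul hy 1 3 ht).const_mul c using 2
  ring

namespace IsDualSolution

theorem intervalIntegrable_norm_forcing_sq (hs : IsDualSolution ν T f y₀ y dy z)
    (ht : t ∈ Icc 0 T) : IntervalIntegrable (fun s => ‖f s‖ ^ 2) volume 0 t :=
  (intervalIntegrable_iff_integrableOn_Ioo_of_le ht.1).2
    ((integrableOn_norm_sq hs.memLp_forcing).mono_set (Ioo_subset_Ioo_right ht.2))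

theorem intervalIntegrable_deriv_apply (hs : IsDualSolution ν T f y₀ y dy z) (B : V →L[ℝ] V)
    (ht : t ∈ Icc 0 T) : IntervalIntegrable (fun s => 2 * dy s (B (y s))) volume 0 t := by
  have hT : IntegrableOn (fun s => dy s (B (y s))) (Ioo 0 T) := by
    refine Integrable.mono' (hs.memW.integrableOn_deriv.norm.mul_const (‖B‖ * normLp ⊤ T y))
      (isBoundedBilinearMap_apply.continuous.comp_aestronglyMeasurable
        (hs.memW.memLp_deriv.1.prodMk (B.continuous.comp_aestronglyMeasurable hs.memLp_top.1))) ?_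
    filter_upwards [ae_norm_le_normLp hs.memLp_top] with s hsM
    refine (ContinuousLinearMap.le_opNorm _ _).trans ?_
    gcongr
    exact (B.le_opNorm _).trans (by gcongr)
  exact ((intervalIntegrable_iff_integrableOn_Ioo_of_le ht.1).2
    (hT.mono_set (Ioo_subset_Ioo_right ht.2))).const_mul 2

theorem norm_sq_le_add_integral (hs : IsDualSolution ν T f y₀ y dy z) (hT : 0 < T)
    {D : H →L[ℝ] H} {B : V →L[ℝ] V}
    (hDB : ∀ (f : H) (v : V), inner ℝ (D f) (D (toH v)) = inner ℝ f (toH (B v)))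
    {g : ℝ → ℝ} (ht : t ∈ Icc 0 T) (hg : IntervalIntegrable g volume 0 t)
    (hle : ∀ᵐ s ∂timeMeasure T, 2 * burgersField ν (f s) (y s) (B (y s)) ≤ g s) :
    ‖D (z t)‖ ^ 2 ≤ ‖D (toH y₀)‖ ^ 2 + ∫ s in 0..t, g s := by
  have hchain :=
    hs.memW.norm_sq_sub_eq_integral hT hs.memLp_top hs.continuousOn hs.ae_toH_eq hDB ht
  have hmono : ∫ s in 0..t, 2 * dy s (B (y s)) ≤ ∫ s in 0..t, g s := by
    refine intervalIntegral.integral_mono_ae_restrict ht.1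
      (hs.intervalIntegrable_deriv_apply B ht) hg ?_
    rw [← restrict_Ioo_eq_restrict_Icc]
    refine ae_restrict_of_ae_restrict_of_subset (Ioo_subset_Ioo_right ht.2) ?_
    filter_upwards [hs.ae_deriv_eq, hle] with s hds hles
    rwa [hds]
  rw [hs.initial] at hchain
  linarith

theorem energy_le (hs : IsDualSolution ν T f y₀ y dy z) (hT : 0 < T) (ht : t ∈ Icc 0 T) :
    ‖z t‖ ^ 2 + 2 * ν * ∫ s in 0..t, ‖dx (y s)‖ ^ 2
      ≤ ‖toH y₀‖ ^ 2 + normLp 2 T f ^ 2 + ∫ s in 0..t, ‖toH (y s)‖ ^ 2 := by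
  have hf := hs.intervalIntegrable_norm_forcing_sq ht
  have ha := intervalIntegrable_norm_toH_sq hs.memLp_top ht
  have hb := (intervalIntegrable_norm_dx_sq hs.memLp_top ht).const_mul (2 * ν)
  have henergy := hs.norm_sq_le_add_integral hT (D := .id ℝ H) (B := .id ℝ V) (fun _ _ => rfl) ht
    ((hf.add ha).sub hb) (.of_forall fun s => two_mul_burgersField_self_le ν (f s) (y s))
  rw [intervalIntegral.integral_sub (hf.add ha) hb, intervalIntegral.integral_add hf ha,
    intervalIntegral.integral_const_mul] at henergy
  simp only [ContinuousLinearMap.id_apply] at henergy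
  linarith [integral_norm_sq_le_normLp_sq hs.memLp_forcing ht]

theorem ae_norm_toH_sq_le (hs : IsDualSolution ν T f y₀ y dy z) (hν : 0 ≤ ν) (hT : 0 < T) :
    ∀ᵐ t ∂timeMeasure T,
      ‖toH (y t)‖ ^ 2 ≤ (‖toH y₀‖ ^ 2 + normLp 2 T f ^ 2) * Real.exp T := by
  have hgronwall := ae_le_mul_exp_of_ae_le_add_integral (a := 0) (b := T)
    (A := ‖toH y₀‖ ^ 2 + normLp 2 T f ^ 2) (β := fun _ => 1) (f := fun t => ‖toH (y t)‖ ^ 2)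
    (by positivity) intervalIntegrable_const (fun _ => zero_le_one)
    (by simpa only [one_mul] using
      intervalIntegrable_norm_toH_sq hs.memLp_top (right_mem_Icc.2 hT.le)) ?_
  · simpa using hgronwall
  · filter_upwards [hs.ae_toH_eq, ae_restrict_mem measurableSet_Ioo] with t hyz ht
    have hdiss : 0 ≤ ∫ s in 0..t, ‖dx (y s)‖ ^ 2 :=
      intervalIntegral.integral_nonneg ht.1.le fun s _ => sq_nonneg _
    simp only [hyz, one_mul]
    linarith [hs.energy_le hT (Ioo_subset_Icc_self ht), mul_nonneg hν hdiss]

theorem integral_norm_toH_sq_le (hs : IsDualSolution ν T f y₀ y dy z) (hν : 0 ≤ ν) (hT : 0 < T) :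
    ∫ s in 0..T, ‖toH (y s)‖ ^ 2
      ≤ T * ((‖toH y₀‖ ^ 2 + normLp 2 T f ^ 2) * Real.exp T) := by
  have hle := hs.ae_norm_toH_sq_le hν hT
  rw [timeMeasure, restrict_Ioo_eq_restrict_Icc] at hle
  refine (intervalIntegral.integral_mono_ae_restrict hT.le
    (intervalIntegrable_norm_toH_sq hs.memLp_top (right_mem_Icc.2 hT.le))
    intervalIntegrable_const hle).trans_eq ?_
  rw [intervalIntegral.integral_const, sub_zero, smul_eq_mul]

theorem integral_norm_dx_sq_le (hs : IsDualSolution ν T f y₀ y dy z) (hν : 0 < ν) (hT : 0 < T) :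
    ∫ s in 0..T, ‖dx (y s)‖ ^ 2
      ≤ (‖toH y₀‖ ^ 2 + normLp 2 T f ^ 2) * ((1 + T * Real.exp T) / (2 * ν)) := by
  rw [← mul_div_assoc, le_div_iff₀ (by positivity)]
  linarith [hs.energy_le hT (right_mem_Icc.2 hT.le), hs.integral_norm_toH_sq_le hν.le hT,
    sq_nonneg ‖z T‖]

theorem norm_diffQuot_sq_le (hs : IsDualSolution ν T f y₀ y dy z) (hν : 0 < ν) (hT : 0 < T)
    (ht : t ∈ Icc 0 T) {h : ℝ} (hh : h ≠ 0) :
    ‖diffQuot h (z t)‖ ^ 2 ≤ (‖dx y₀‖ ^ 2 + normLp 2 T f ^ 2 / ν)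
      + ∫ s in 0..t, 2 / ν * (‖toH (y s)‖ * ‖dx (y s)‖) * ‖dx (y s)‖ ^ 2 := by
  have hf := (hs.intervalIntegrable_norm_forcing_sq ht).div_const ν
  have hconv := intervalIntegrable_norm_toH_mul_norm_dx_mul_sq hs.memLp_top ht (2 / ν)
  have henergy := hs.norm_sq_le_add_integral hT (inner_diffQuot_diffQuot h) ht (hf.add hconv)
    (.of_forall fun s => two_mul_burgersField_adjointDiffQuotV_le hν (f s) (y s) hh)
  rw [intervalIntegral.integral_add hf hconv, intervalIntegral.integral_div] at henergy
  have hforce : (∫ s in 0..t, ‖f s‖ ^ 2) / ν ≤ normLp 2 T f ^ 2 / ν := by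
    gcongr
    exact integral_norm_sq_le_normLp_sq hs.memLp_forcing ht
  have hinit : ‖diffQuot h (toH y₀)‖ ^ 2 ≤ ‖dx y₀‖ ^ 2 := by
    gcongr
    exact norm_diffQuot_toH_le hh y₀
  linarith

theorem ae_norm_dx_sq_le_add_integral (hs : IsDualSolution ν T f y₀ y dy z) (hν : 0 < ν)
    (hT : 0 < T) : ∀ᵐ t ∂timeMeasure T, ‖dx (y t)‖ ^ 2 ≤ (‖dx y₀‖ ^ 2 + normLp 2 T f ^ 2 / ν)
      + ∫ s in 0..t, 2 / ν * (‖toH (y s)‖ * ‖dx (y s)‖) * ‖dx (y s)‖ ^ 2 := by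
  filter_upwards [hs.ae_toH_eq, ae_restrict_mem measurableSet_Ioo] with t hyz ht
  have hquot {h : ℝ} (hh : h ≠ 0) := hs.norm_diffQuot_sq_le hν hT (Ioo_subset_Icc_self ht) hh
  have hnonneg := (sq_nonneg _).trans (hquot one_ne_zero)
  rw [← Real.le_sqrt (norm_nonneg _) hnonneg]
  refine norm_dx_le_of_norm_diffQuot_le fun h hh => ?_
  rw [hyz]
  exact Real.le_sqrt_of_sq_le (hquot hh)

theorem integral_norm_toH_mul_norm_dx_le (hs : IsDualSolution ν T f y₀ y dy z) (hν : 0 < ν)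
    (hT : 0 < T) : ∫ s in 0..T, 2 / ν * (‖toH (y s)‖ * ‖dx (y s)‖)
      ≤ transportRate ν T * (‖toH y₀‖ ^ 2 + normLp 2 T f ^ 2) := by
  have hTT : T ∈ Icc 0 T := right_mem_Icc.2 hT.le
  have ha := intervalIntegrable_norm_toH_sq hs.memLp_top hTT
  have hb := intervalIntegrable_norm_dx_sq hs.memLp_top hTT
  calc ∫ s in 0..T, 2 / ν * (‖toH (y s)‖ * ‖dx (y s)‖)
      ≤ ∫ s in 0..T, (‖toH (y s)‖ ^ 2 + ‖dx (y s)‖ ^ 2) / ν := by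
        refine intervalIntegral.integral_mono hT.le
          (intervalIntegrable_norm_toH_mul_norm_dx hs.memLp_top hTT _)
          ((ha.add hb).div_const ν) fun s => ?_
        simp only [div_mul_eq_mul_div, ← norm_sq_V]
        gcongr
        exact two_mul_norm_toH_mul_norm_dx_le (y s)
    _ = ((∫ s in 0..T, ‖toH (y s)‖ ^ 2) + ∫ s in 0..T, ‖dx (y s)‖ ^ 2) / ν := by
        rw [intervalIntegral.integral_div, intervalIntegral.integral_add ha hb]
    _ ≤ _ := by
        rw [transportRate, div_mul_eq_mul_div]
        gcongr
        linarith [hs.integral_norm_toH_sq_le hν.le hT, hs.integral_norm_dx_sq_le hν hT]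

theorem ae_norm_dx_sq_le (hs : IsDualSolution ν T f y₀ y dy z) (hν : 0 < ν) (hT : 0 < T) :
    ∀ᵐ t ∂timeMeasure T, ‖dx (y t)‖ ^ 2 ≤ (‖dx y₀‖ ^ 2 + normLp 2 T f ^ 2 / ν)
      * Real.exp (transportRate ν T * (‖toH y₀‖ ^ 2 + normLp 2 T f ^ 2)) := by
  have hTT : T ∈ Icc 0 T := right_mem_Icc.2 hT.le
  filter_upwards [ae_le_mul_exp_of_ae_le_add_integral (by positivity)
    (intervalIntegrable_norm_toH_mul_norm_dx hs.memLp_top hTT (2 / ν)) (fun t => by positivity)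
    (intervalIntegrable_norm_toH_mul_norm_dx_mul_sq hs.memLp_top hTT (2 / ν))
    (hs.ae_norm_dx_sq_le_add_integral hν hT)] with t ht
  refine ht.trans ?_
  gcongr
  exact hs.integral_norm_toH_mul_norm_dx_le hν hT

theorem ae_norm_le (hs : IsDualSolution ν T f y₀ y dy z) (hν : 0 < ν) (hT : 0 < T) :
    ∀ᵐ t ∂timeMeasure T, ‖y t‖ ≤ √(Real.exp T + 1 + 1 / ν) * (normLp 2 T f + ‖y₀‖)
      * Real.exp (transportRate ν T * (‖toH y₀‖ ^ 2 + normLp 2 T f ^ 2)) := by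
  have hN : 0 ≤ normLp 2 T f := ENNReal.toReal_nonneg
  set S := normLp 2 T f + ‖y₀‖
  set G := Real.exp (transportRate ν T * (‖toH y₀‖ ^ 2 + normLp 2 T f ^ 2))
  have hG : 1 ≤ G :=
    Real.one_le_exp (mul_nonneg (transportRate_nonneg hν.le hT.le) (by positivity))
  have hdata : ‖toH y₀‖ ^ 2 + normLp 2 T f ^ 2 ≤ S ^ 2 := by
    nlinarith [norm_toH_le y₀, norm_nonneg (toH y₀), mul_nonneg hN (norm_nonneg y₀)]
  have hdx₀ : ‖dx y₀‖ ≤ S := (norm_dx_le y₀).trans (le_add_of_nonneg_left hN)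
  have hNS : normLp 2 T f ≤ S := le_add_of_nonneg_right (norm_nonneg y₀)
  filter_upwards [hs.ae_norm_toH_sq_le hν.le hT, hs.ae_norm_dx_sq_le hν hT] with t htoH hdx
  refine le_of_pow_le_pow_left₀ two_ne_zero (by positivity) ?_
  calc ‖y t‖ ^ 2 = ‖toH (y t)‖ ^ 2 + ‖dx (y t)‖ ^ 2 := norm_sq_V _
    _ ≤ S ^ 2 * Real.exp T + (S ^ 2 + S ^ 2 / ν) * G := by
        refine add_le_add (htoH.trans ?_) (hdx.trans ?_) <;> gcongr
    _ ≤ S ^ 2 * Real.exp T * G ^ 2 + (S ^ 2 + S ^ 2 / ν) * G ^ 2 := by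
        gcongr ?_ + _ * ?_
        · exact le_mul_of_one_le_right (by positivity) (one_le_pow₀ hG)
        · exact le_self_pow₀ hG two_ne_zero
    _ = (√(Real.exp T + 1 + 1 / ν) * S * G) ^ 2 := by
        rw [mul_pow, mul_pow, Real.sq_sqrt (by positivity)]
        ring

theorem ae_norm_toH_le_exp (hs : IsDualSolution ν T f y₀ y dy z) (hν : 0 ≤ ν) (hT : 0 < T) :
    ∀ᵐ t ∂timeMeasure T,
      ‖toH (y t)‖ ≤ Real.exp (Real.exp T * (‖toH y₀‖ ^ 2 + normLp 2 T f ^ 2)) := by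
  filter_upwards [hs.ae_norm_toH_sq_le hν hT] with t ht
  have hexp := Real.add_one_le_exp (Real.exp T * (‖toH y₀‖ ^ 2 + normLp 2 T f ^ 2))
  nlinarith [sq_nonneg (‖toH (y t)‖ - 1)]

theorem ae_norm_deriv_le (hs : IsDualSolution ν T f y₀ y dy z) (hν : 0 < ν) (hT : 0 < T) :
    ∀ᵐ t ∂timeMeasure T, ‖dy t‖ ≤ (1 + ν) * (√(Real.exp T + 1 + 1 / ν) * (normLp 2 T f + ‖y₀‖)
      * Real.exp ((transportRate ν T + Real.exp T) * (‖toH y₀‖ ^ 2 + normLp 2 T f ^ 2)))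
      + ‖f t‖ := by
  rw [add_mul (transportRate ν T), Real.exp_add]
  set E := Real.exp (Real.exp T * (‖toH y₀‖ ^ 2 + normLp 2 T f ^ 2))
  have hE : 1 ≤ E := Real.one_le_exp (by positivity)
  filter_upwards [hs.ae_deriv_eq, hs.ae_norm_toH_le_exp hν.le hT, hs.ae_norm_le hν hT]
    with t hdy htoH hy
  set R := √(Real.exp T + 1 + 1 / ν) * (normLp 2 T f + ‖y₀‖)
    * Real.exp (transportRate ν T * (‖toH y₀‖ ^ 2 + normLp 2 T f ^ 2))
  have hdx : ‖dx (y t)‖ ≤ R := (norm_dx_le _).trans hy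
  calc ‖dy t‖ ≤ ‖f t‖ + ‖toH (y t)‖ * ‖dx (y t)‖ + ν * ‖dx (y t)‖ :=
        hdy ▸ norm_burgersField_le hν.le _ _
    _ ≤ ‖f t‖ + E * R + ν * (E * R) := by
        gcongr
        exact hdx.trans (le_mul_of_one_le_left ((norm_nonneg _).trans hdx) hE)
    _ = _ := by ring

theorem normLp_top_add_normW_le (hs : IsDualSolution ν T f y₀ y dy z) (hν : 0 < ν)
    (hT : 0 < T) : normLp ⊤ T y + normW T y dy
      ≤ (1 + (1 + √T * (2 + ν)) * √(Real.exp T + 1 + 1 / ν)) * (normLp 2 T f + ‖y₀‖)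
        * Real.exp ((transportRate ν T + Real.exp T)
          * (‖toH y₀‖ ^ 2 + normLp 2 T f ^ 2)) := by
  have hN : 0 ≤ normLp 2 T f := ENNReal.toReal_nonneg
  have hderiv := hs.ae_norm_deriv_le hν hT
  have hrate := transportRate_nonneg hν.le hT.le
  set S := normLp 2 T f + ‖y₀‖
  set Q := ‖toH y₀‖ ^ 2 + normLp 2 T f ^ 2
  set G := Real.exp ((transportRate ν T + Real.exp T) * Q)
  set R := √(Real.exp T + 1 + 1 / ν) * S * G with hR
  have hyR : ∀ᵐ t ∂timeMeasure T, ‖y t‖ ≤ R := by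
    filter_upwards [hs.ae_norm_le hν hT] with t ht
    refine ht.trans ?_
    dsimp only [R, G]
    gcongr
    exact le_add_of_nonneg_right (Real.exp_nonneg T)
  have hsup : normLp ⊤ T y ≤ R := normLp_top_le (by positivity) hyR
  have hL2 : normLp 2 T y ≤ √T * R := by
    simpa [normLp] using normLp_two_le_of_ae_norm_le hT.le (by positivity) (MemLp.zero (ε := ℝ))
      (hyR.mono fun t ht => by simpa using ht)
  have hL2deriv : normLp 2 T dy ≤ √T * ((1 + ν) * R) + normLp 2 T f :=
    normLp_two_le_of_ae_norm_le hT.le (by positivity) hs.memLp_forcing hderiv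
  have hforcing : normLp 2 T f ≤ S * G :=
    (le_add_of_nonneg_right (norm_nonneg y₀)).trans
      (le_mul_of_one_le_right (by positivity) (Real.one_le_exp (by positivity)))
  calc normLp ⊤ T y + normW T y dy
      ≤ R + (√T * R + (√T * ((1 + ν) * R) + S * G)) := by
        linarith [normW_le_add T y dy]
    _ = _ := by
        rw [hR]
        ring

end IsDualSolution

end Estimates

theorem exists_a_priori_estimate {ν T : ℝ} (hν : 0 < ν) (hT : 0 < T) :
    ∃ C : ℝ, 0 < C ∧ ∀ (f : ℝ → H) (y₀ : V) (y : ℝ → V) (dy : ℝ → VDual) (z : ℝ → H),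
      IsDualSolution ν T f y₀ y dy z → normLp ⊤ T y + normW T y dy
        ≤ C * (normLp 2 T f + ‖y₀‖) * Real.exp (C * (normLp 2 T f ^ 2 + ‖toH y₀‖ ^ 2)) := by
  have hrate := transportRate_nonneg hν.le hT.le
  set K := 1 + (1 + √T * (2 + ν)) * √(Real.exp T + 1 + 1 / ν)
  have hK : 0 < K := by positivity
  have hγ : 0 ≤ transportRate ν T + Real.exp T := by positivity
  refine ⟨K + (transportRate ν T + Real.exp T), by positivity, fun f y₀ y dy z hs => ?_⟩
  have hN : 0 ≤ normLp 2 T f := ENNReal.toReal_nonneg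
  refine (hs.normLp_top_add_normW_le hν hT).trans ?_
  rw [add_comm (‖toH y₀‖ ^ 2)]
  gcongr ?_ * _ * Real.exp (?_ * _) <;> linarith

theorem mul_exp_scaled_le {C k a b : ℝ} (hC : 0 ≤ C) (hk : 0 ≤ k) (ha : 0 ≤ a) (hb : 0 ≤ b)
    (c : ℝ) : C * (k * a + b) * Real.exp (C * ((k * a) ^ 2 + c ^ 2))
      ≤ C * (1 + k) ^ 2 * (a + b) * Real.exp (C * (1 + k) ^ 2 * (a ^ 2 + c ^ 2)) := by
  have hlin : k * a + b ≤ (1 + k) ^ 2 * (a + b) := by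
    nlinarith [mul_nonneg hk ha, mul_nonneg hk hb, mul_nonneg (sq_nonneg k) (add_nonneg ha hb)]
  have hquad : (k * a) ^ 2 + c ^ 2 ≤ (1 + k) ^ 2 * (a ^ 2 + c ^ 2) := by
    nlinarith [mul_nonneg hk (sq_nonneg a), mul_nonneg hk (sq_nonneg c), sq_nonneg (k * c)]
  rw [mul_assoc C (_ ^ 2), mul_assoc C (_ ^ 2)]
  gcongr

end Burgers

end

theorem mainTheorem7_general (ν T : ℝ) (hν : 0 < ν) (hT : 0 < T)
    (χ : ℝ → ℝ) (hχ : MemLp χ 2 volume) :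
    ∃ C : ℝ, 0 < C ∧
      ∀ (u : ℝ → ℝ) (y₀ : Burgers.V) (y : ℝ → Burgers.V) (dy : ℝ → Burgers.VDual),
        MemLp u 2 (Burgers.timeMeasure T) →
        Burgers.MemW T y dy →
        MemLp y ⊤ (Burgers.timeMeasure T) →
        Burgers.IsWeakSolution ν T χ u y₀ y →
        Burgers.normLp ⊤ T y + Burgers.normW T y dy
          ≤ C * (Burgers.normLp 2 T u + ‖y₀‖) *
              Real.exp (C * (Burgers.normLp 2 T u ^ 2 + ‖Burgers.toH y₀‖ ^ 2)) := by
  obtain ⟨C, hC, hbound⟩ := Burgers.exists_a_priori_estimate hν hT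
  refine ⟨C * (1 + ‖hχ.toLp χ‖) ^ 2, by positivity, fun u y₀ y dy hu hW hy hsol => ?_⟩
  obtain ⟨z, hz, hyz, hz0⟩ := hsol.initial
  have hforcing : MemLp (fun t => u t • hχ.toLp χ) 2 (Burgers.timeMeasure T) :=
    (ContinuousLinearMap.toSpanSingleton ℝ (hχ.toLp χ)).comp_memLp' hu
  refine (hbound _ y₀ y dy z
    ⟨hforcing, hW, hy, hz, hyz, ext_inner_right ℝ hz0, hsol.ae_deriv_eq hW hχ⟩).trans ?_
  rw [Burgers.normLp_smul_const]
  exact Burgers.mul_exp_scaled_le hC.le (norm_nonneg _) ENNReal.toReal_nonneg (norm_nonneg _) _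

theorem mainTheorem7 (ν T : ℝ) (hν : 0 < ν) (hT : 0 < T)
    (χ : ℝ → ℝ) (hχ : ContDiff ℝ ∞ χ) (hχc : HasCompactSupport χ) :
    ∃ C : ℝ, 0 < C ∧
      ∀ (u : ℝ → ℝ) (y₀ : Burgers.V) (y : ℝ → Burgers.V) (dy : ℝ → Burgers.VDual),
        Burgers.MemH1Time T u →
        Burgers.HasBoundedSupport y₀ →
        Burgers.MemW T y dy →
        MemLp y ⊤ (Burgers.timeMeasure T) →
        Burgers.IsWeakSolution ν T χ u y₀ y →
        Burgers.normLp ⊤ T y + Burgers.normW T y dy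
          ≤ C * (Burgers.normLp 2 T u + ‖y₀‖) *
              Real.exp (C * (Burgers.normLp 2 T u ^ 2 + ‖Burgers.toH y₀‖ ^ 2)) :=
  let ⟨C, hC, h⟩ := mainTheorem7_general ν T hν hT χ (hχ.continuous.memLp_of_hasCompactSupport hχc)
  ⟨C, hC, fun u y₀ y dy hu _ => h u y₀ y dy hu.1⟩
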